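/- Let $1\le m\le n$ be integers and let $\ell=(\ell_1,\dots,\ell_r)$ be positive integers with $\ell_1+\cdots+\ell_r=n$. Notation. For a field $K$, $f\in K[x]$ of degree $n$ and $a\in K[x]$, let $M_a\in K^{n\times n}$ be the matrix of multiplication by $a$ on $K[x]/(f)$ in the basis $1,x,\dots,x^{n-1}$, let $X\in K^{n\times m}$ be the transpose of $(I_m\;\;0)$, and put $H_k=X^{\mathsf T}M_a^kX\in K^{m\times m}$ for $k\ge0$. Let $H_{m,d}=(H_{i+j})_{0\le i,j<d}\in K^{md\times md}$ be the associated block Hankel matrix. Let $\nu_m$ be the sum of the degrees of the $m$ invariant factors of highest degree of the characteristic matrix $yI_n-M_a\in K[y]^{n\times n}$. Given an algebraic closure $\overline K$ of $K$ and $\xi_1,\dots,\xi_n\in\overline K$, we say that $a$ takes values $\lambda_1,\dots,\lambda_r$ at $\xi_1,\dots,\xi_n$ with multiplicities $\ell_1,\dots,\ell_r$ if $\lambda_1,\dots,\lambda_r\in\overline K$ are pairwise distinct and $a(\xi_k)=\lambda_i$ whenever $\ell_1+\cdots+\ell_{i-1}<k\le\ell_1+\cdots+\ell_i$. Proposition.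 There exists a nonzero polynomial $\Gamma_{\ell,m}\in\mathbb Z[\bar\xi_1,\dots,\bar\xi_n,\bar\lambda_1,\dots,\bar\lambda_r]$, depending only on $\ell$ and $m$, such that for every field $K$ with algebraic closure $\overline K$ the following holds. (1) Let $\xi_1,\dots,\xi_n\in\overline K$ be pairwise distinct and nonzero and let $c\in K\setminus\{0\}$ be such that $f=c(x-\xi_1)\cdots(x-\xi_n)$ lies in $K[x]$, and let $a\in K[x]$ take values $\lambda_1,\dots,\lambda_r$ at $\xi_1,\dots,\xi_n$ with multiplicities $\ell_1,\dots,\ell_r$. Then $$\nu_m=\sum_{i=1}^r\min(\ell_i,m),$$ and if $\Gamma_{\ell,m}(\xi_1,\dots,\xi_n,\lambda_1,\dots,\lambda_r)\ne0$, then $\operatorname{rank}H_{m,d}=\nu_m$ for every integer $d\ge\lceil\nu_m/m\rceil$. (2) For any pairwise distinct $\lambda_1,\dots,\lambda_r\in\overline K$, the polynomial $\Gamma_{\ell,m}(\bar\xi_1,\dots,\bar\xi_n,\lambda_1,\dots,\lambda_r)\in\overline K[\bar\xi_1,\dots,\bar\xi_n]$ is nonzero and has total degree at most $2n^2$. -/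

import Mathlib

open Polynomial

noncomputable section

namespace BlockHankel

/-- The matrix of multiplication by `a` on `K[x]/(f)` in the basis `1, x, …, x^(n-1)`, for a
polynomial `f` of degree `n`: column `j` holds the coefficients of `x^j a rem f`. -/
def mulMatrix {K : Type*} [Field K] (n : ℕ) (a f : K[X]) : Matrix (Fin n) (Fin n) K :=
  Matrix.of fun i j => ((X ^ (j : ℕ) * a) % f).coeff (i : ℕ)

/-- The `n × m` matrix whose transpose is `(I_m 0)`. -/
def projMatrix (K : Type*) [Field K] (n m : ℕ) : Matrix (Fin n) (Fin m) K :=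
  Matrix.of fun i j => if (i : ℕ) = (j : ℕ) then 1 else 0

/-- The `m × m` matrix `H_k = Xᵀ M_a^k X`, with `X` the projection matrix. -/
def hankelBlock {K : Type*} [Field K] (n m : ℕ) (a f : K[X]) (k : ℕ) :
    Matrix (Fin m) (Fin m) K :=
  (projMatrix K n m).transpose * mulMatrix n a f ^ k * projMatrix K n m

/-- The block Hankel matrix with `d × d` blocks of size `m × m`, whose block in position
`(i, j)`, `0 ≤ i, j < d`, is `H_{i+j}`. -/
def blockHankel {K : Type*} [Field K] (n m d : ℕ) (a f : K[X]) :
    Matrix (Fin d × Fin m) (Fin d × Fin m) K :=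
  Matrix.of fun p q => hankelBlock n m a f ((p.1 : ℕ) + (q.1 : ℕ)) p.2 q.2

/-- The ideal generated by the `k × k` minors of a square matrix. (Choices of rows or columns
with a repetition give zero determinants and reorderings only change signs, so they do not
affect the ideal.) -/
def minorIdeal {R : Type*} [CommRing R] {n : ℕ} (A : Matrix (Fin n) (Fin n) R) (k : ℕ) :
    Ideal R :=
  Ideal.span {p | ∃ rows cols : Fin k → Fin n, p = (A.submatrix rows cols).det}

/-- The `k`-th determinantal divisor of a polynomial matrix: the gcd of its `k × k` minors,
determined up to a unit (it is a unit for `k = 0`). -/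
def detDivisor {K : Type*} [Field K] {n : ℕ} (A : Matrix (Fin n) (Fin n) K[X]) (k : ℕ) : K[X] :=
  Submodule.IsPrincipal.generator (minorIdeal A k)

/-- The `k`-th invariant factor, `1 ≤ k ≤ n`, of a polynomial matrix, up to a unit: the exact
quotient of the `k`-th determinantal divisor by the `(k-1)`-st. With this indexing each invariant
factor divides the next one. -/
def invariantFactor {K : Type*} [Field K] {n : ℕ} (A : Matrix (Fin n) (Fin n) K[X]) (k : ℕ) :
    K[X] :=
  detDivisor A k / detDivisor A (k - 1)

/-- `ν_m`: the sum of the degrees of the `m` invariant factors of highest degree of the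
characteristic matrix `y I_n - M_a`, for `m ≤ n`. Since each invariant factor divides the next,
these are the ones with indices `n - m + 1, …, n`. -/
def nu {K : Type*} [Field K] (n m : ℕ) (a f : K[X]) : ℕ :=
  ∑ k ∈ Finset.Icc (n - m + 1) n, (invariantFactor (mulMatrix n a f).charmatrix k).natDegree

/-- The polynomial `a` takes the values `lam 0, …, lam (r-1)` at `xi 0, …, xi (n-1)` with
multiplicities `ℓ 0, …, ℓ (r-1)`: the values are pairwise distinct, the multiplicities are positive
with sum `n`, and the first `ℓ 0` points are sent to `lam 0`, the next `ℓ 1` points to `lam 1`,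
and so on. -/
structure TakesValues {K L : Type*} [Field K] [Field L] [Algebra K L] {n r : ℕ}
    (a : K[X]) (xi : Fin n → L) (lam : Fin r → L) (ℓ : Fin r → ℕ) : Prop where
  distinct : Function.Injective lam
  pos : ∀ i, 0 < ℓ i
  sum_eq : ∑ i, ℓ i = n
  value : ∀ (i : Fin r) (k : Fin n), ∑ j ∈ Finset.Iio i, ℓ j ≤ (k : ℕ) →
    (k : ℕ) < (∑ j ∈ Finset.Iio i, ℓ j) + ℓ i → aeval (xi k) a = lam i

end BlockHankel

end

/-! Evaluation at the roots of `f` conjugates `M_a` to the diagonal matrix of the values `μ_k =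
a(ξ_k)`, the Vandermonde matrix being the change of basis. Ideals of minors are invariant under
conjugation, so the `k`-th determinantal divisor is the gcd of the `k`-fold products of the `y -
μ_j`, of degree `∑ max(ℓ_i - (n - k), 0)`. Degrees of successive quotients telescope to `ν = ∑
min(ℓ_i, m)` (`sum_natDegree_invariantFactor`).

The same diagonalization factors the block Hankel matrix through the matrix with rows `(μ_k^j
ξ_k^q)`, to whose rank each class contributes at most `min(ℓ_i, m)`; this bounds the rank above. For
the lower bound, expanding the Lagrange coefficients in powers of `1/ξ_k` splits an invertible
triangular factor off the leading `ν × ν` submatrix and leaves, up to sign, the matrix `B` =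
`weightedGram` (`le_rank_blockHankel`). The polynomial `Γ` is `det B` with denominators cleared,
written as a bordered determinant whose Schur complement is `-B`; this form also gives the degree
bound.

It remains that `det B` is not identically zero for fixed distinct `λ_i`. On `ν` points, `min(ℓ_i,
m)` from each class, `B` is a product of square matrices, nonsingular by interpolation on a grid of
monomials. The other points are then brought in from infinity one at a time. -/

namespace BlockHankel

/-! ### Ideals of minors -/

section Minors

variable {R : Type*} [CommRing R] {n : ℕ}

lemma minorIdeal_mul_le_right (A B : Matrix (Fin n) (Fin n) R) (k : ℕ) :
    minorIdeal (A * B) k ≤ minorIdeal B k := by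
  refine Ideal.span_le.2 ?_
  rintro _ ⟨r, c, rfl⟩
  have h : ((A * B).submatrix r c) =
      fun i => ∑ l, A (r i) l • (fun j => B l (c j)) := by
    ext i j
    simp [Matrix.mul_apply, Finset.sum_apply]
  have h2 : ((A * B).submatrix r c).det = ∑ φ : Fin k → Fin n,
      (∏ i, A (r i) (φ i)) • (B.submatrix φ c).det := by
    rw [h]
    change Matrix.detRowAlternating.toMultilinearMap _ = _
    rw [MultilinearMap.map_sum]
    refine Finset.sum_congr rfl fun φ _ => ?_
    rw [MultilinearMap.map_smul_univ]
    rfl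
  rw [SetLike.mem_coe, h2]
  exact Ideal.sum_mem _ fun φ _ => Ideal.mul_mem_left _ _ (Ideal.subset_span ⟨φ, c, rfl⟩)

lemma minorIdeal_transpose_le (A : Matrix (Fin n) (Fin n) R) (k : ℕ) :
    minorIdeal A.transpose k ≤ minorIdeal A k := by
  refine Ideal.span_le.2 ?_
  rintro _ ⟨r, c, rfl⟩
  refine Ideal.subset_span ⟨c, r, ?_⟩
  rw [← Matrix.det_transpose, Matrix.transpose_submatrix, Matrix.transpose_transpose]

lemma minorIdeal_transpose (A : Matrix (Fin n) (Fin n) R) (k : ℕ) :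
    minorIdeal A.transpose k = minorIdeal A k :=
  le_antisymm (minorIdeal_transpose_le A k)
    (by simpa using minorIdeal_transpose_le A.transpose k)

lemma minorIdeal_mul_le_left (A B : Matrix (Fin n) (Fin n) R) (k : ℕ) :
    minorIdeal (A * B) k ≤ minorIdeal A k := by
  rw [← minorIdeal_transpose, Matrix.transpose_mul, ← minorIdeal_transpose A]
  exact minorIdeal_mul_le_right _ _ _

lemma minorIdeal_eq_of_conj {A B P Q : Matrix (Fin n) (Fin n) R} (hPQ : P * Q = 1)
    (h : P * A = B * P) (k : ℕ) : minorIdeal A k = minorIdeal B k := by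
  have hQP : Q * P = 1 := mul_eq_one_comm.1 hPQ
  have hA : A = Q * (B * P) := by rw [← h, ← mul_assoc, hQP, one_mul]
  have hB : B = P * A * Q := by rw [h, mul_assoc, hPQ, mul_one]
  apply le_antisymm
  · rw [hA]
    exact (minorIdeal_mul_le_right _ _ _).trans (minorIdeal_mul_le_left _ _ _)
  · rw [hB]
    exact (minorIdeal_mul_le_left _ _ _).trans (minorIdeal_mul_le_right _ _ _)

lemma map_minorIdeal {S : Type*} [CommRing S] (φ : R →+* S) (A : Matrix (Fin n) (Fin n) R)
    (k : ℕ) : (minorIdeal A k).map φ = minorIdeal (A.map φ) k := by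
  rw [minorIdeal, minorIdeal, Ideal.map_span]
  congr 1
  ext p
  constructor
  · rintro ⟨_, ⟨r, c, rfl⟩, rfl⟩
    exact ⟨r, c, by rw [RingHom.map_det]; rfl⟩
  · rintro ⟨r, c, rfl⟩
    exact ⟨_, ⟨r, c, rfl⟩, by rw [RingHom.map_det]; rfl⟩

lemma minorIdeal_diagonal_le (d : Fin n → R) (k : ℕ) (g : R)
    (hg : ∀ S : Finset (Fin n), S.card = k → g ∣ ∏ i ∈ S, d i) :
    minorIdeal (Matrix.diagonal d) k ≤ Ideal.span {g} := by
  refine Ideal.span_le.2 ?_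
  rintro _ ⟨r, c, rfl⟩
  rw [SetLike.mem_coe, Ideal.mem_span_singleton]
  by_cases hc : Function.Injective c
  · rw [Matrix.det_apply']
    refine Finset.dvd_sum fun s _ => dvd_mul_of_dvd_right ?_ _
    by_cases h : ∀ i, r (s i) = c i
    · have : ∏ i, (Matrix.diagonal d).submatrix r c (s i) i = ∏ i ∈ Finset.univ.image c, d i := by
        rw [Finset.prod_image (fun _ _ _ _ h => hc h)]
        refine Finset.prod_congr rfl fun i _ => ?_
        simp [h i]
      rw [this]
      exact hg _ (by rw [Finset.card_image_of_injective _ hc]; simp)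
    · push Not at h
      obtain ⟨i, hi⟩ := h
      rw [Finset.prod_eq_zero (Finset.mem_univ i) (by simp [hi])]
      exact dvd_zero _
  · simp only [Function.Injective, not_forall] at hc
    obtain ⟨i, j, hij, hne⟩ := hc
    rw [Matrix.det_zero_of_column_eq hne (fun l => by simp [hij])]
    exact dvd_zero _

lemma prod_mem_minorIdeal_diagonal (d : Fin n → R) (S : Finset (Fin n)) :
    ∏ i ∈ S, d i ∈ minorIdeal (Matrix.diagonal d) S.card := by
  refine Ideal.subset_span ⟨S.orderEmbOfFin rfl, S.orderEmbOfFin rfl, ?_⟩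
  rw [Matrix.submatrix_diagonal _ _ (S.orderEmbOfFin rfl).injective, Matrix.det_diagonal]
  conv_lhs => rw [← Finset.image_orderEmbOfFin_univ S rfl]
  rw [Finset.prod_image (fun _ _ _ _ h => (S.orderEmbOfFin rfl).injective h)]
  rfl

end Minors

/-- A set of `k` indices meeting a given class in as few elements as possible. -/
lemma exists_card_eq_of_class {ι : Type*} [Fintype ι] [DecidableEq ι] (T : Finset ι) {k : ℕ}
    (hk : k ≤ Fintype.card ι) :
    ∃ S : Finset ι, S.card = k ∧ (S ∩ T).card = T.card - (Fintype.card ι - k) := by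
  -- The set is built through its complement `U`, of size `card ι - k`, which either swallows `T` or
  -- lies inside it.
  rcases le_total T.card (Fintype.card ι - k) with h | h
  · obtain ⟨U, hTU, -, hU⟩ := Finset.exists_subsuperset_card_eq (Finset.subset_univ T) h
      (Nat.sub_le _ _)
    refine ⟨Uᶜ, by rw [Finset.card_compl, hU]; omega, ?_⟩
    rw [Nat.sub_eq_zero_of_le h, Finset.card_eq_zero, ← Finset.disjoint_iff_inter_eq_empty]
    exact (disjoint_compl_left).mono_right hTU
  · obtain ⟨U, hUT, hU⟩ := Finset.exists_subset_card_eq h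
    refine ⟨Uᶜ, by rw [Finset.card_compl, hU]; omega, ?_⟩
    rw [← hU, ← Finset.card_sdiff_of_subset hUT]
    congr 1
    ext x
    simp [and_comm]

/-! ### Invariant factors of a diagonalizable matrix -/

section Field

variable {L : Type*} [Field L] {n r : ℕ}

lemma prod_classes (σ : Fin n → Fin r) (lam : Fin r → L) (S : Finset (Fin n)) :
    ∏ k ∈ S, (X - C (lam (σ k))) =
      ∏ i, (X - C (lam i)) ^ (S ∩ Finset.univ.filter (σ · = i)).card := by
  rw [← Finset.prod_fiberwise S σ]
  refine Finset.prod_congr rfl fun i _ => ?_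
  have : S ∩ Finset.univ.filter (σ · = i) = S.filter (σ · = i) := by ext; simp
  rw [this, ← Finset.prod_const]
  exact Finset.prod_congr rfl fun k hk => by rw [(Finset.mem_filter.1 hk).2]

lemma rootMultiplicity_prod_classes {lam : Fin r → L} (hlam : Function.Injective lam)
    (e : Fin r → ℕ) (i : Fin r) :
    (∏ j, (X - C (lam j)) ^ e j).rootMultiplicity (lam i) = e i := by
  classical
  have h0 : ∏ j, (X - C (lam j)) ^ e j ≠ 0 :=
    Finset.prod_ne_zero_iff.2 fun j _ => pow_ne_zero _ (X_sub_C_ne_zero _)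
  rw [← count_roots, roots_prod _ _ h0, Multiset.count_bind]
  simp only [roots_pow, roots_X_sub_C, Multiset.count_nsmul, Multiset.count_singleton]
  change ∑ j, _ = _
  simp [hlam.eq_iff]

lemma natDegree_prod_classes (lam : Fin r → L) (e : Fin r → ℕ) :
    (∏ j, (X - C (lam j)) ^ e j).natDegree = ∑ j, e j := by
  rw [natDegree_prod_of_monic _ _ fun j _ => (monic_X_sub_C _).pow _]
  simp

lemma natDegree_of_span_eq_minorIdeal_diagonal [IsAlgClosed L] {lam : Fin r → L}
    (hlam : Function.Injective lam) (σ : Fin n → Fin r) {k : ℕ} (hk : k ≤ n) {g : L[X]}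
    (hg : Ideal.span {g} = minorIdeal (Matrix.diagonal fun i => X - C (lam (σ i))) k) :
    g ≠ 0 ∧ g.natDegree = ∑ i, ((Finset.univ.filter (σ · = i)).card - (n - k)) := by
  classical
  set cl : Fin r → Finset (Fin n) := fun i => Finset.univ.filter (σ · = i) with hcl
  have hdvd : ∀ S : Finset (Fin n), S.card = k → g ∣ ∏ i ∈ S, (X - C (lam (σ i))) := by
    rintro S rfl
    rw [← Ideal.mem_span_singleton, hg]
    exact prod_mem_minorIdeal_diagonal _ S
  have hne : ∀ S : Finset (Fin n), ∏ i ∈ S, (X - C (lam (σ i))) ≠ 0 := fun S =>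
    Finset.prod_ne_zero_iff.2 fun j _ => X_sub_C_ne_zero _
  have hg0 : g ≠ 0 := by
    obtain ⟨S, hS, -⟩ := exists_card_eq_of_class (ι := Fin n) ∅ (k := k) (by simpa using hk)
    exact ne_zero_of_dvd_ne_zero (hne S) (hdvd S hS)
  refine ⟨hg0, le_antisymm ?_ ?_⟩
  -- All roots of `g` are among the `λ_i`; each multiplicity is bounded by using the `k`-set that
  -- meets class `i` least.
  · have hroots : ∀ i, g.rootMultiplicity (lam i) ≤ (cl i).card - (n - k) := by
      intro i
      obtain ⟨S, hS, hSi⟩ := exists_card_eq_of_class (ι := Fin n) (cl i) (k := k) (by simpa using hk)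
      have := rootMultiplicity_le_rootMultiplicity_of_dvd (hne S) (hdvd S hS) (lam i)
      rw [prod_classes, rootMultiplicity_prod_classes hlam] at this
      rw [Fintype.card_fin] at hSi
      exact this.trans hSi.le
    have hsub : g.roots.toFinset ⊆ Finset.univ.image lam := by
      intro z hz
      obtain ⟨S, hS, -⟩ := exists_card_eq_of_class (ι := Fin n) ∅ (k := k) (by simpa using hk)
      have hz : g.IsRoot z := by simpa [hg0] using hz
      have := hz.dvd (hdvd S hS)
      rw [IsRoot.def, eval_prod, Finset.prod_eq_zero_iff] at this
      obtain ⟨j, -, hj⟩ := this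
      simp only [eval_sub, eval_X, eval_C] at hj
      exact Finset.mem_image.2 ⟨σ j, Finset.mem_univ _, (sub_eq_zero.1 hj).symm⟩
    rw [← IsAlgClosed.card_roots_eq_natDegree, ← Multiset.sum_count_eq_card (s := Finset.univ.image lam)
      (fun a ha => hsub (Multiset.mem_toFinset.2 ha)),
      Finset.sum_image fun _ _ _ _ h => hlam h]
    exact Finset.sum_le_sum fun i _ => by rw [count_roots]; exact hroots i
  -- A `k`-set omits only `n - k` indices, so it contains at least `ℓ_i - (n - k)` of class `i`: the
  -- expected product divides all minors.
  · rw [← natDegree_prod_classes lam]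
    refine natDegree_le_of_dvd ?_ hg0
    rw [← Ideal.mem_span_singleton]
    refine minorIdeal_diagonal_le _ k _ (fun S hS => ?_) (hg ▸ Ideal.mem_span_singleton_self g)
    rw [prod_classes]
    refine Finset.prod_dvd_prod_of_dvd _ _ fun i _ => pow_dvd_pow _ ?_
    have h1 := Finset.card_union_add_card_inter S (cl i)
    have h2 := Finset.card_le_univ (S ∪ cl i)
    rw [Fintype.card_fin] at h2
    change (cl i).card - (n - k) ≤ (S ∩ cl i).card
    omega

/-- Ideals of minors commute with extension of scalars, so the degree over `K` can be read off over
`L`, where `M` becomes diagonal. -/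
lemma natDegree_detDivisor {K : Type*} [Field K] [Algebra K L] [IsAlgClosed L]
    {lam : Fin r → L} (hlam : Function.Injective lam) (σ : Fin n → Fin r)
    (M : Matrix (Fin n) (Fin n) K) {V W : Matrix (Fin n) (Fin n) L} (hVW : V * W = 1)
    (hV : V * M.map (algebraMap K L) = Matrix.diagonal (fun k => lam (σ k)) * V)
    {k : ℕ} (hk : k ≤ n) :
    detDivisor M.charmatrix k ≠ 0 ∧ (detDivisor M.charmatrix k).natDegree =
      ∑ i, ((Finset.univ.filter (σ · = i)).card - (n - k)) := by
  set g := detDivisor M.charmatrix k with hgdef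
  have hg : Ideal.span {g} = minorIdeal M.charmatrix k := by
    rw [hgdef, detDivisor]
    exact Ideal.span_singleton_generator _
  set V' := (C : L →+* L[X]).mapMatrix V
  have key : V' * (M.map (algebraMap K L)).charmatrix =
      (Matrix.diagonal fun k => lam (σ k)).charmatrix * V' := by
    rw [Matrix.charmatrix, Matrix.charmatrix, mul_sub, sub_mul, ← map_mul, ← map_mul, hV]
    congr 1
    exact ((Matrix.scalar_commute _ (fun _ => Commute.all _ _) V').eq).symm
  have h := minorIdeal_eq_of_conj (Q := (C : L →+* L[X]).mapMatrix W)
    (by rw [← map_mul, hVW, map_one]) key k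
  rw [Matrix.charmatrix_map, Matrix.charmatrix_diagonal] at h
  have h2 := map_minorIdeal (mapRingHom (algebraMap K L)) M.charmatrix k
  rw [← hg, Ideal.map_span, Set.image_singleton] at h2
  obtain ⟨h3, h4⟩ := natDegree_of_span_eq_minorIdeal_diagonal hlam σ hk (h2.trans h)
  rw [coe_mapRingHom] at h3 h4
  refine ⟨fun h0 => h3 (by rw [h0, Polynomial.map_zero]), ?_⟩
  rw [← h4, natDegree_map]

lemma natDegree_div_eq (p q : L[X]) (hq : q ≠ 0) :
    (p / q).natDegree = p.natDegree - q.natDegree := by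
  rw [div_def, natDegree_C_mul (inv_ne_zero (leadingCoeff_ne_zero.2 hq)),
    natDegree_divByMonic _ (monic_mul_leadingCoeff_inv hq), mul_comm,
    natDegree_C_mul (inv_ne_zero (leadingCoeff_ne_zero.2 hq))]

/-- Passing from `m'` to `m' + 1` adds the invariant factor of index `n - m'`, whose degree counts
the classes with more than `m'` elements. -/
lemma sum_natDegree_invariantFactor {K : Type*} [Field K] [Algebra K L] [IsAlgClosed L]
    {lam : Fin r → L} (hlam : Function.Injective lam) (σ : Fin n → Fin r)
    (M : Matrix (Fin n) (Fin n) K) {V W : Matrix (Fin n) (Fin n) L} (hVW : V * W = 1)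
    (hV : V * M.map (algebraMap K L) = Matrix.diagonal (fun k => lam (σ k)) * V)
    {m : ℕ} (hm : m ≤ n) :
    ∑ k ∈ Finset.Icc (n - m + 1) n, (invariantFactor M.charmatrix k).natDegree =
      ∑ i, min (Finset.univ.filter (σ · = i)).card m := by
  have step : ∀ m' ≤ n, ∑ k ∈ Finset.Icc (n - m' + 1) n,
      (invariantFactor M.charmatrix k).natDegree =
      ∑ i, min (Finset.univ.filter (σ · = i)).card m' := by
    intro m'
    induction m' with
    | zero => simp
    | succ m' ih =>
      intro h
      have e : Finset.Icc (n - (m' + 1) + 1) n =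
          insert (n - m') (Finset.Icc (n - m' + 1) n) := by
        ext x; simp only [Finset.mem_Icc, Finset.mem_insert]; omega
      rw [e, Finset.sum_insert (by simp), ih (by omega), invariantFactor]
      obtain ⟨-, h1⟩ := natDegree_detDivisor hlam σ M hVW hV (k := n - m') (by omega)
      obtain ⟨h2, h3⟩ := natDegree_detDivisor hlam σ M hVW hV (k := n - m' - 1) (by omega)
      rw [natDegree_div_eq _ _ h2, h1, h3, ← Finset.sum_tsub_distrib _ (fun i _ => by omega),
        ← Finset.sum_add_distrib]
      refine Finset.sum_congr rfl fun i _ => ?_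
      omega
  exact step m hm

end Field

/-! ### Rank under field extension and the upper bound -/

section Rank

variable {K L : Type*} [Field K] [Field L] [Algebra K L]

/-- The rank normal form and the invertibility of its transforming matrices survive the extension.
-/
lemma rank_map_algebraMap {ι : Type*} [Fintype ι] [DecidableEq ι] (M : Matrix ι ι K) :
    (M.map (algebraMap K L)).rank = M.rank := by
  classical
  obtain ⟨V, U, e, hV, hU, h⟩ := M.exists_rank_normal_form
  have hdiag : ∀ (F : Type _) [Field F], ((Matrix.fromBlocks 1 0 0 0 :
      Matrix (Fin M.rank ⊕ Fin (Fintype.card ι - M.rank)) _ F).submatrix e e).rank = M.rank := by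
    intro F _
    rw [Matrix.rank_submatrix]
    have : (Matrix.fromBlocks 1 0 0 0 :
        Matrix (Fin M.rank ⊕ Fin (Fintype.card ι - M.rank)) _ F) =
        Matrix.diagonal (Sum.elim 1 0) := by
      rw [← Matrix.fromBlocks_diagonal]
      simp [← Matrix.diagonal_one, ← Matrix.diagonal_zero]
    rw [this, Matrix.rank_diagonal, Fintype.card_subtype]
    have hfilter : (Finset.univ.filter fun x : Fin M.rank ⊕ Fin (Fintype.card ι - M.rank) =>
        (Sum.elim 1 0 x : F) ≠ 0) = Finset.univ.map Function.Embedding.inl := by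
      ext x
      rcases x with x | x <;> simp
    rw [hfilter, Finset.card_map, Finset.card_univ, Fintype.card_fin]
  have hL : V.map (algebraMap K L) * M.map (algebraMap K L) * U.map (algebraMap K L) =
      (Matrix.fromBlocks 1 0 0 0).submatrix e e := by
    rw [← Matrix.map_mul, ← Matrix.map_mul, h]
    ext i j
    rw [Matrix.map_apply, Matrix.submatrix_apply, Matrix.submatrix_apply]
    rcases e i with x | x <;> rcases e j with y | y <;> simp [Matrix.one_apply, apply_ite]
  have hV' : IsUnit (V.map (algebraMap K L)).det :=
    (Matrix.isUnit_iff_isUnit_det _).1 (hV.map (algebraMap K L).mapMatrix)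
  have hU' : IsUnit (U.map (algebraMap K L)).det :=
    (Matrix.isUnit_iff_isUnit_det _).1 (hU.map (algebraMap K L).mapMatrix)
  rw [← hdiag L, ← hL, Matrix.rank_mul_eq_left_of_isUnit_det _ _ hU',
    Matrix.rank_mul_eq_right_of_isUnit_det _ _ hV']

lemma rank_sum_le {ι κ τ : Type*} [Fintype ι] [Fintype κ] (s : Finset τ)
    (A : τ → Matrix ι κ L) : (∑ i ∈ s, A i).rank ≤ ∑ i ∈ s, (A i).rank := by
  classical
  induction s using Finset.induction_on with
  | empty => simp [Matrix.rank_zero]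
  | insert a s ha ih =>
    rw [Finset.sum_insert ha, Finset.sum_insert ha]
    refine le_trans ?_ (Nat.add_le_add_left ih _)
    generalize ∑ i ∈ s, A i = B
    rw [Matrix.rank, Matrix.rank, Matrix.rank]
    refine le_trans (Submodule.finrank_mono ?_) (Submodule.finrank_add_le_finrank_add_finrank _ _)
    rw [Matrix.mulVecLin_add]
    exact LinearMap.range_add_le _ _

/-- The matrix with rows `(μ_k^j ξ_k^q)_{j < d, q < m}` has rank at most `∑ min(ℓ_i, m)`, where
`ℓ_i` is the number of rows with `μ_k = λ_i`. -/
lemma rank_krylov_le {n r m d : ℕ} (σ : Fin n → Fin r) (lam : Fin r → L) (ξ : Fin n → L) :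
    (Matrix.of fun (k : Fin n) (q : Fin d × Fin m) =>
      lam (σ k) ^ (q.1 : ℕ) * ξ k ^ (q.2 : ℕ)).rank ≤
      ∑ i, min (Finset.univ.filter (σ · = i)).card m := by
  classical
  set Q := Matrix.of fun (k : Fin n) (q : Fin d × Fin m) =>
      lam (σ k) ^ (q.1 : ℕ) * ξ k ^ (q.2 : ℕ) with hQ
  have hsum : Q = ∑ i, Matrix.diagonal (fun k => if σ k = i then (1 : L) else 0) * Q := by
    rw [← Matrix.sum_mul]
    have : ∑ i, Matrix.diagonal (fun k => if σ k = i then (1 : L) else 0) = 1 := by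
      ext k k'
      rw [Matrix.sum_apply, Matrix.one_apply]
      by_cases h : k = k'
      · subst h; simp
      · simp [h]
    rw [this, Matrix.one_mul]
  rw [hsum]
  refine (rank_sum_le _ _).trans (Finset.sum_le_sum fun i _ => le_min ?_ ?_)
  · refine (Matrix.rank_mul_le_left _ _).trans ?_
    rw [Matrix.rank_diagonal, Fintype.card_subtype]
    simp
  -- Inside one class `μ_k` is constant, so the rows are determined by the `m` powers `ξ_k^q`.
  · have : Matrix.diagonal (fun k => if σ k = i then (1 : L) else 0) * Q =
        (Matrix.of fun (k : Fin n) (q : Fin m) => if σ k = i then ξ k ^ (q : ℕ) else 0) *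
        (Matrix.of fun (q : Fin m) (p : Fin d × Fin m) =>
          if q = p.2 then lam i ^ (p.1 : ℕ) else 0) := by
      ext k p
      rw [Matrix.diagonal_mul, Matrix.mul_apply]
      by_cases h : σ k = i
      · simp [h, hQ, mul_comm]
      · simp [h]
    rw [this]
    refine (Matrix.rank_mul_le_left _ _).trans ((Matrix.rank_le_card_width _).trans ?_)
    simp

end Rank

/-! ### Diagonalization by evaluation at the roots -/

section Interpolation

variable {K L : Type*} [Field K] [Field L] [Algebra K L] {n m : ℕ}

lemma sum_coeff_mul_pow_fin {R : Type*} [CommSemiring R] {p : R[X]} (hp : p.natDegree < n)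
    (x : R) : ∑ i : Fin n, x ^ (i : ℕ) * p.coeff i = p.eval x := by
  rw [eval_eq_sum_range' hp, ← Fin.sum_univ_eq_sum_range (fun i => p.coeff i * x ^ i)]
  exact Finset.sum_congr rfl fun i _ => mul_comm _ _

lemma natDegree_eq_of_map_eq_prod {ξ : Fin n → L} {c : K} {f : K[X]} (hc : c ≠ 0)
    (hf : f.map (algebraMap K L) = C (algebraMap K L c) * ∏ k, (X - C (ξ k))) :
    f.natDegree = n := by
  rw [← natDegree_map (algebraMap K L), hf,
    natDegree_C_mul ((map_ne_zero (algebraMap K L)).2 hc),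
    natDegree_prod_of_monic _ _ fun _ _ => monic_X_sub_C _]
  simp

/-- Evaluation at the roots of `f` diagonalizes multiplication by `a` modulo `f`. -/
lemma vandermonde_mul_mulMatrix {ξ : Fin n → L} {c : K} {f : K[X]} (a : K[X]) (hc : c ≠ 0)
    (hn : 0 < n)
    (hf : f.map (algebraMap K L) = C (algebraMap K L c) * ∏ k, (X - C (ξ k))) :
    Matrix.vandermonde ξ * (mulMatrix n a f).map (algebraMap K L) =
      Matrix.diagonal (fun k => aeval (ξ k) a) * Matrix.vandermonde ξ := by
  have hdeg := natDegree_eq_of_map_eq_prod hc hf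
  ext k j
  rw [Matrix.mul_apply, Matrix.diagonal_mul]
  simp only [Matrix.vandermonde_apply, Matrix.map_apply, mulMatrix, Matrix.of_apply]
  simp_rw [← coeff_map]
  have hlt : ((X ^ (j : ℕ) * a) % f).natDegree < n :=
    (natDegree_mod_lt _ (by omega)).trans_eq hdeg
  rw [sum_coeff_mul_pow_fin (by rwa [natDegree_map]), eval_map_algebraMap]
  have hroot : aeval (ξ k) f = 0 := by
    rw [← eval_map_algebraMap, hf, eval_mul, eval_prod,
      Finset.prod_eq_zero (Finset.mem_univ k) (by simp), mul_zero]
  have h := congrArg (aeval (ξ k)) (EuclideanDomain.div_add_mod (X ^ (j : ℕ) * a) f)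
  rw [map_add, map_mul, hroot, zero_mul, zero_add, map_mul, map_pow, aeval_X] at h
  rw [h, mul_comm]

/-- The coefficients of the Lagrange basis polynomials. -/
noncomputable def lagrangeMatrix (ξ : Fin n → L) : Matrix (Fin n) (Fin n) L :=
  Matrix.of fun p k => (∏ j ∈ Finset.univ.erase k, (X - C (ξ j))).coeff (p : ℕ) *
    (∏ j ∈ Finset.univ.erase k, (ξ k - ξ j))⁻¹

lemma prod_sub_ne_zero {ι : Type*} [DecidableEq ι] {ξ : ι → L} {A : Finset ι}
    (hξ : Set.InjOn ξ A) {k : ι} (hk : k ∈ A) :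
    ∏ j ∈ A.erase k, (ξ k - ξ j) ≠ 0 :=
  Finset.prod_ne_zero_iff.2 fun _ hj => sub_ne_zero.2 fun h =>
    (Finset.ne_of_mem_erase hj) (hξ hk (Finset.mem_of_mem_erase hj) h).symm

lemma vandermonde_mul_lagrangeMatrix {ξ : Fin n → L} (hξ : Function.Injective ξ) :
    Matrix.vandermonde ξ * lagrangeMatrix ξ = 1 := by
  ext k' k
  rw [Matrix.mul_apply]
  simp only [Matrix.vandermonde_apply, lagrangeMatrix, Matrix.of_apply, ← mul_assoc]
  rw [← Finset.sum_mul, sum_coeff_mul_pow_fin, eval_prod, Matrix.one_apply]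
  · simp only [eval_sub, eval_X, eval_C]
    split_ifs with h
    · subst h
      exact mul_inv_cancel₀ (prod_sub_ne_zero hξ.injOn (Finset.mem_univ _))
    · rw [Finset.prod_eq_zero (Finset.mem_erase.2 ⟨h, Finset.mem_univ _⟩) (sub_self _), zero_mul]
  · rw [natDegree_prod_of_monic _ _ fun _ _ => monic_X_sub_C _]
    have := k.pos
    simp
    omega

/-- The coefficients of `∏_{j ≠ k} (x - ξ_j)` from a power series expansion of
`∏_j (x - ξ_j) / (x - ξ_k)` at the origin. -/
lemma coeff_prod_erase {ι : Type*} [DecidableEq ι] {ξ : ι → L} {A : Finset ι} {k : ι}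
    (hk : k ∈ A) (h0 : ξ k ≠ 0) (p : ℕ) :
    (∏ j ∈ A.erase k, (X - C (ξ j))).coeff p =
      -∑ q ∈ Finset.range (p + 1), (∏ j ∈ A, (X - C (ξ j))).coeff (p - q) * (ξ k ^ q * ξ k)⁻¹ := by
  rw [← Finset.mul_prod_erase A _ hk]
  set g := ∏ j ∈ A.erase k, (X - C (ξ j))
  have hsucc : ∀ q, ((X - C (ξ k)) * g).coeff (q + 1) = g.coeff q - ξ k * g.coeff (q + 1) := by
    intro q; rw [sub_mul, coeff_sub, coeff_X_mul, coeff_C_mul]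
  induction p with
  | zero => simp [sub_mul]; field_simp
  | succ p ih =>
    rw [Finset.sum_range_succ', ← mul_right_inj' h0]
    have h1 : ∑ q ∈ Finset.range (p + 1), ((X - C (ξ k)) * g).coeff (p + 1 - (q + 1)) *
        (ξ k ^ (q + 1) * ξ k)⁻¹ = (ξ k)⁻¹ * ∑ q ∈ Finset.range (p + 1),
        ((X - C (ξ k)) * g).coeff (p - q) * (ξ k ^ q * ξ k)⁻¹ := by
      rw [Finset.mul_sum]
      refine Finset.sum_congr rfl fun q _ => ?_
      rw [Nat.add_sub_add_right]
      field_simp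
      ring
    rw [h1, neg_eq_iff_eq_neg.1 ih.symm, Nat.sub_zero, hsucc]
    field_simp
    ring

lemma hankelBlock_apply (hmn : m ≤ n) (a f : K[X]) (k : ℕ) (p q : Fin m) :
    hankelBlock n m a f k p q =
      (mulMatrix n a f ^ k) (Fin.castLE hmn p) (Fin.castLE hmn q) := by
  have hX : projMatrix K n m = (1 : Matrix (Fin n) (Fin n) K).submatrix id (Fin.castLE hmn) := by
    ext i j
    simp [projMatrix, Matrix.one_apply, Fin.ext_iff]
  rw [hankelBlock, hX]
  simp [Matrix.mul_apply, Matrix.one_apply]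

lemma map_hankelBlock_apply {ξ : Fin n → L} (hξ : Function.Injective ξ) {c : K} {a f : K[X]}
    (hc : c ≠ 0) (hn : 0 < n)
    (hf : f.map (algebraMap K L) = C (algebraMap K L c) * ∏ k, (X - C (ξ k)))
    (hmn : m ≤ n) (i : ℕ) (p q : Fin m) :
    algebraMap K L (hankelBlock n m a f i p q) =
      ∑ k, lagrangeMatrix ξ (Fin.castLE hmn p) k * (aeval (ξ k) a) ^ i * ξ k ^ (q : ℕ) := by
  have hVW := vandermonde_mul_lagrangeMatrix hξ
  have hWV := mul_eq_one_comm.1 hVW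
  have hV := vandermonde_mul_mulMatrix a hc hn hf
  have hpow : (mulMatrix n a f).map (algebraMap K L) ^ i =
      lagrangeMatrix ξ * (Matrix.diagonal fun k => aeval (ξ k) a) ^ i * Matrix.vandermonde ξ := by
    have : SemiconjBy (Matrix.vandermonde ξ) ((mulMatrix n a f).map (algebraMap K L) ^ i)
        ((Matrix.diagonal fun k => aeval (ξ k) a) ^ i) := SemiconjBy.pow_right hV i
    rw [mul_assoc, ← this.eq, ← mul_assoc, hWV, one_mul]
  rw [hankelBlock_apply hmn]
  have h2 := congrFun (congrFun hpow (Fin.castLE hmn p)) (Fin.castLE hmn q)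
  have h3 : (mulMatrix n a f).map (algebraMap K L) ^ i =
      (mulMatrix n a f ^ i).map (algebraMap K L) :=
    (map_pow (algebraMap K L).mapMatrix (mulMatrix n a f) i).symm
  rw [h3, Matrix.map_apply] at h2
  rw [h2, Matrix.diagonal_pow, Matrix.mul_apply]
  refine Finset.sum_congr rfl fun k _ => ?_
  rw [Matrix.mul_diagonal]
  simp [Matrix.vandermonde_apply]

lemma rank_blockHankel_le {r d : ℕ} {ξ : Fin n → L} (hξ : Function.Injective ξ) {c : K}
    {a f : K[X]} (hc : c ≠ 0) (hn : 0 < n)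
    (hf : f.map (algebraMap K L) = C (algebraMap K L c) * ∏ k, (X - C (ξ k)))
    (hmn : m ≤ n) (σ : Fin n → Fin r) (lam : Fin r → L)
    (hσ : ∀ k, aeval (ξ k) a = lam (σ k)) :
    (blockHankel n m d a f).rank ≤ ∑ i, min (Finset.univ.filter (σ · = i)).card m := by
  rw [← rank_map_algebraMap (L := L)]
  have : (blockHankel n m d a f).map (algebraMap K L) =
      (Matrix.of fun (p : Fin d × Fin m) k =>
        lagrangeMatrix ξ (Fin.castLE hmn p.2) k * lam (σ k) ^ (p.1 : ℕ)) *
      Matrix.of fun (k : Fin n) (q : Fin d × Fin m) =>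
        lam (σ k) ^ (q.1 : ℕ) * ξ k ^ (q.2 : ℕ) := by
    ext p q
    rw [Matrix.map_apply, blockHankel, Matrix.of_apply, map_hankelBlock_apply hξ hc hn hf hmn,
      Matrix.mul_apply]
    refine Finset.sum_congr rfl fun k _ => ?_
    rw [hσ, pow_add, Matrix.of_apply, Matrix.of_apply]
    ring
  rw [this]
  exact (Matrix.rank_mul_le_right _ _).trans (rank_krylov_le σ lam ξ)

end Interpolation

/-! ### Reduction of the lower bound to a weighted Gram matrix -/

section Gram

variable {L : Type*} [Field L] {ι : Type*} [DecidableEq ι]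

/-- The matrix with entry `∑_{k ∈ A} μ_k^{⌊s/m⌋+⌊t/m⌋} ξ_k^{t mod m - s mod m} / (ξ_k F'(ξ_k))` in
position `(s, t)`, where `F = ∏_{j ∈ A} (x - ξ_j)`. -/
noncomputable def weightedGram (m ν : ℕ) (A : Finset ι) (ξ μ : ι → L) : Matrix (Fin ν) (Fin ν) L :=
  Matrix.of fun s t => ∑ k ∈ A, (ξ k * ∏ j ∈ A.erase k, (ξ k - ξ j))⁻¹ *
    μ k ^ ((s : ℕ) / m + (t : ℕ) / m) * ξ k ^ ((t : ℕ) % m) * (ξ k ^ ((s : ℕ) % m))⁻¹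

lemma le_rank_blockHankel {K : Type*} [Field K] [Algebra K L] {n m ν d : ℕ} {ξ : Fin n → L}
    (hξ : Function.Injective ξ) (hξ0 : ∀ k, ξ k ≠ 0) {c : K} {a f : K[X]} (hc : c ≠ 0)
    (hm : 0 < m) (hmn : m ≤ n)
    (hf : f.map (algebraMap K L) = C (algebraMap K L c) * ∏ k, (X - C (ξ k)))
    (hd : ν ≤ m * d) (hB : (weightedGram m ν Finset.univ ξ fun k => aeval (ξ k) a).det ≠ 0) :
    ν ≤ (blockHankel n m d a f).rank := by
  set F := ∏ k, (X - C (ξ k)) with hF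
  set B := weightedGram m ν Finset.univ ξ fun k => aeval (ξ k) a with hBdef
  let idx : Fin ν → Fin d × Fin m := fun t =>
    (⟨t / m, Nat.div_lt_of_lt_mul (t.2.trans_le hd)⟩, ⟨t % m, Nat.mod_lt _ hm⟩)
  -- Diagonal blocks are lower triangular Toeplitz matrices in the coefficients of `F`, as in
  -- `coeff_prod_erase`. Row `s` uses only `s' ≤ s`, so cutting the last block at `ν` loses nothing;
  -- the diagonal is `F(0) ≠ 0`.
  let U : Matrix (Fin ν) (Fin ν) L := Matrix.of fun s s' =>
    if (s' : ℕ) / m = s / m ∧ (s' : ℕ) % m ≤ s % m then F.coeff (s % m - s' % m) else 0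
  have hU : U.det ≠ 0 := by
    rw [Matrix.det_of_isLowerTriangular]
    · refine Finset.prod_ne_zero_iff.2 fun s _ => ?_
      simp only [U, Matrix.of_apply, le_refl, and_self, if_true, Nat.sub_self]
      rw [coeff_zero_eq_eval_zero, hF, eval_prod]
      exact Finset.prod_ne_zero_iff.2 fun k _ => by simpa using hξ0 k
    · intro s s' (hss : s < s')
      simp only [U, Matrix.of_apply]
      rw [if_neg]
      rintro ⟨h1, h2⟩
      have e1 := Nat.div_add_mod (s : ℕ) m
      have e2 := Nat.div_add_mod (s' : ℕ) m
      rw [h1] at e2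
      have : (s : ℕ) < s' := hss
      omega
  have hmul : ((blockHankel n m d a f).submatrix idx idx).map (algebraMap K L) = U * -B := by
    ext s t
    have hsum : ∀ g : ℕ → L, ∑ s' : Fin ν, U s s' * g ((s' : ℕ) % m) =
        ∑ q ∈ Finset.range ((s : ℕ) % m + 1), F.coeff ((s : ℕ) % m - q) * g q := by
      intro g
      simp only [U, Matrix.of_apply, ite_mul, zero_mul]
      rw [← Finset.sum_filter]
      refine Finset.sum_bij' (fun s' _ => (s' : ℕ) % m)
        (fun q hq => ⟨m * ((s : ℕ) / m) + q, ?_⟩) ?_ ?_ ?_ ?_ ?_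
      · have e1 := Nat.div_add_mod (s : ℕ) m
        have := s.2
        have := Finset.mem_range.1 hq
        omega
      · intro s' hs'
        have := (Finset.mem_filter.1 hs').2.2
        exact Finset.mem_range.2 (by omega)
      · intro q hq
        have h1 := Finset.mem_range.1 hq
        have h2 := Nat.mod_lt (s : ℕ) hm
        have h3 : q < m := by omega
        refine Finset.mem_filter.2 ⟨Finset.mem_univ _, ?_, ?_⟩
        · simp [Nat.mul_add_div hm, Nat.div_eq_of_lt h3]
        · simp [Nat.mod_eq_of_lt h3]; omega
      · intro s' hs'
        have h := (Finset.mem_filter.1 hs').2.1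
        apply Fin.ext
        simp only [← h]
        exact Nat.div_add_mod _ _
      · intro q hq
        have h1 := Finset.mem_range.1 hq
        have h2 := Nat.mod_lt (s : ℕ) hm
        simp [Nat.mod_eq_of_lt (show q < m by omega)]
      · intro s' hs'
        rfl
    have hdiv : ∀ g : ℕ → ℕ → L, ∑ s' : Fin ν, U s s' * g ((s' : ℕ) / m) ((s' : ℕ) % m) =
        ∑ s' : Fin ν, U s s' * g ((s : ℕ) / m) ((s' : ℕ) % m) := by
      intro g
      refine Finset.sum_congr rfl fun s' _ => ?_
      simp only [U, Matrix.of_apply]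
      split_ifs with h
      · rw [h.1]
      · simp
    rw [Matrix.map_apply, Matrix.submatrix_apply, blockHankel, Matrix.of_apply,
      map_hankelBlock_apply hξ hc (hm.trans_le hmn) hf hmn, Matrix.mul_neg, Matrix.neg_apply,
      Matrix.mul_apply]
    simp only [hBdef, weightedGram, Matrix.of_apply, lagrangeMatrix, Fin.val_castLE, idx]
    rw [hdiv (fun x y => ∑ k, (ξ k * ∏ j ∈ Finset.univ.erase k, (ξ k - ξ j))⁻¹ *
      (aeval (ξ k) a) ^ (x + (t : ℕ) / m) * ξ k ^ ((t : ℕ) % m) * (ξ k ^ y)⁻¹),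
      hsum (fun y => ∑ k, (ξ k * ∏ j ∈ Finset.univ.erase k, (ξ k - ξ j))⁻¹ *
      (aeval (ξ k) a) ^ ((s : ℕ) / m + (t : ℕ) / m) * ξ k ^ ((t : ℕ) % m) * (ξ k ^ y)⁻¹)]
    simp only [Finset.mul_sum]
    rw [Finset.sum_comm, ← Finset.sum_neg_distrib]
    refine Finset.sum_congr rfl fun k _ => ?_
    rw [coeff_prod_erase (Finset.mem_univ k) (hξ0 k), ← hF]
    simp only [neg_mul, Finset.sum_mul, mul_inv]
    congr 1
    refine Finset.sum_congr rfl fun q _ => ?_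
    ring
  have hdet : (((blockHankel n m d a f).submatrix idx idx).map (algebraMap K L)).det ≠ 0 := by
    rw [hmul, Matrix.det_mul, Matrix.det_neg]
    exact mul_ne_zero hU (mul_ne_zero (pow_ne_zero _ (neg_ne_zero.2 one_ne_zero)) hB)
  have h := Matrix.rank_of_det_ne_zero hdet
  rw [rank_map_algebraMap, Fintype.card_fin] at h
  exact h.symm.le.trans (Matrix.rank_submatrix_le _ _ _)

end Gram

/-! ### Nonvanishing at some choice of points -/

section Nonvanishing

variable {L : Type*} [Field L]

lemma eq_zero_of_sum_range_mul_pow_eq_zero {N : ℕ} {v w : ℕ → L} (hv : Set.InjOn v (Set.Iio N))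
    (h : ∀ j < N, ∑ i ∈ Finset.range N, w i * v j ^ i = 0) : ∀ i < N, w i = 0 := by
  have := Matrix.eq_zero_of_forall_index_sum_mul_pow_eq_zero (f := fun j : Fin N => v j)
    (v := fun i : Fin N => w i) (fun i j hij => Fin.ext (hv i.2 j.2 hij)) (fun j => by
      rw [← h j j.2, ← Fin.sum_univ_eq_sum_range (fun i => w i * v j ^ i)])
  exact fun i hi => congrFun this ⟨i, hi⟩

lemma sum_range_mul_eq {M : Type*} [AddCommMonoid M] (m D : ℕ) (g : ℕ → M) :
    ∑ x ∈ Finset.range (m * D), g x =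
      ∑ j ∈ Finset.range D, ∑ q ∈ Finset.range m, g (m * j + q) := by
  induction D with
  | zero => simp
  | succ D ih => rw [Nat.mul_succ, Finset.sum_range_add, ih, Finset.sum_range_succ]

/-- The matrix of bivariate monomials `y^{⌊s/m⌋} x^{s mod m}` at the points `(μ_t, ξ_t)`. -/
def monomialMatrix {R : Type*} [CommSemiring R] {ι : Type*} (m ν : ℕ) (μ ξ : ι → R) :
    Matrix ι (Fin ν) R :=
  Matrix.of fun t s => μ t ^ ((s : ℕ) / m) * ξ t ^ ((s : ℕ) % m)

/-- A kernel vector is a polynomial `∑ y^i R_i(x)` vanishing at all points. On each line `x = η_q`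
there are enough points to kill it as a polynomial in `y`, and then the `R_i` vanish at enough
`η_q`. -/
lemma det_monomialMatrix_grid_ne_zero {m ν : ℕ} (hm : 0 < m) {μ : Fin ν → L} {η : ℕ → L}
    (hη : Set.InjOn η (Set.Iio m))
    (hμ : ∀ t t' : Fin ν, (t : ℕ) % m = (t' : ℕ) % m → μ t = μ t' → t = t') :
    (monomialMatrix m ν μ fun t => η ((t : ℕ) % m)).det ≠ 0 := by
  intro h0
  obtain ⟨v, hv0, hv⟩ := Matrix.exists_mulVec_eq_zero_iff.2 h0
  apply hv0
  set D := ν / m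
  have hD : m * D + ν % m = ν := Nat.div_add_mod ν m
  have hρ : ν % m < m := Nat.mod_lt _ hm
  let c : ℕ → L := fun x => if h : x < ν then v ⟨x, h⟩ else 0
  let μ' : ℕ → ℕ → L := fun q j => if h : m * j + q < ν then μ ⟨m * j + q, h⟩ else 0
  let R : ℕ → L → L := fun j y => ∑ q ∈ Finset.range m, c (m * j + q) * y ^ q
  have hc : ∀ x, ν ≤ x → c x = 0 := fun x hx => dif_neg (by omega)
  have hmod : ∀ j q, q < m → (m * j + q) % m = q := fun j q hq => by
    rw [Nat.mul_add_mod, Nat.mod_eq_of_lt hq]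
  have hdiv : ∀ j q, q < m → (m * j + q) / m = j := fun j q hq => by
    rw [Nat.mul_add_div hm, Nat.div_eq_of_lt hq, add_zero]
  have hE : ∀ q < m, ∀ j, m * j + q < ν →
      ∑ i ∈ Finset.range (D + 1), R i (η q) * μ' q j ^ i = 0 := by
    intro q hq j hj
    have h1 := congrFun hv ⟨m * j + q, hj⟩
    simp only [Matrix.mulVec, dotProduct, monomialMatrix, Matrix.of_apply, Pi.zero_apply] at h1
    rw [hmod j q hq] at h1
    have h2 : ∑ x ∈ Finset.range (m * (D + 1)),
        c x * (μ' q j ^ (x / m) * η q ^ (x % m)) = 0 := by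
      rw [← Finset.sum_subset (Finset.range_mono (show ν ≤ m * (D + 1) by
        rw [Nat.mul_succ]; omega)) fun x _ hx => by
          rw [hc x (by simpa using hx), zero_mul], ← Fin.sum_univ_eq_sum_range
          (fun x => c x * (μ' q j ^ (x / m) * η q ^ (x % m))), ← h1]
      refine Finset.sum_congr rfl fun x _ => ?_
      simp only [c, μ', x.2, hj, dif_pos]
      ring
    rw [sum_range_mul_eq] at h2
    rw [← h2]
    refine Finset.sum_congr rfl fun i _ => ?_
    simp only [R, Finset.sum_mul]
    refine Finset.sum_congr rfl fun p hp => ?_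
    rw [hdiv _ _ (Finset.mem_range.1 hp), hmod _ _ (Finset.mem_range.1 hp)]
    ring
  have hinj : ∀ q < m, ∀ N, (∀ j < N, m * j + q < ν) → Set.InjOn (μ' q) (Set.Iio N) := by
    intro q hq N hN j hj j' hj' h
    simp only [μ', hN j hj, hN j' hj', dif_pos] at h
    have := congrArg Fin.val (hμ _ _ (by simp only [hmod _ _ hq]) h)
    simp only at this
    exact Nat.eq_of_mul_eq_mul_left hm (by omega)
  -- Only the first `ν % m` lines carry `D + 1` points, which is just enough: the top coefficient
  -- `R_D` has only `ν % m` terms.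
  have h1 : ∀ q < ν % m, R D (η q) = 0 := by
    intro q hq
    have hlt : ∀ j < D + 1, m * j + q < ν := fun j hj => by
      have := Nat.mul_le_mul_left m (Nat.lt_succ_iff.1 hj)
      omega
    exact eq_zero_of_sum_range_mul_pow_eq_zero (w := fun i => R i (η q))
      (hinj q (by omega) _ hlt) (fun j hj => hE q (by omega) j (hlt j hj)) D (Nat.lt_succ_self D)
  have h2 : ∀ q, c (m * D + q) = 0 := by
    intro q
    rcases lt_or_ge q (ν % m) with hq | hq
    · refine eq_zero_of_sum_range_mul_pow_eq_zero (w := fun q => c (m * D + q))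
        (hη.mono (Set.Iio_subset_Iio hρ.le)) (fun p hp => ?_) q hq
      rw [← h1 p hp]
      refine Finset.sum_subset (Finset.range_mono hρ.le) fun x _ hx => ?_
      rw [hc _ (by have := Finset.mem_range.not.1 hx; omega), zero_mul]
    · exact hc _ (by omega)
  -- With `R_D = 0` the degree in `y` is below `D`, and every line has `D` points.
  have h3 : ∀ q < m, ∀ i < D, R i (η q) = 0 := by
    intro q hq
    have hlt : ∀ j < D, m * j + q < ν := fun j hj => by
      have := Nat.mul_le_mul_left m (Nat.succ_le_iff.2 hj)
      rw [Nat.mul_succ] at this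
      omega
    refine eq_zero_of_sum_range_mul_pow_eq_zero (hinj q hq _ hlt) fun j hj => ?_
    have := hE q hq j (hlt j hj)
    rwa [Finset.sum_range_succ, show R D (η q) = 0 from Finset.sum_eq_zero fun x _ => by
      rw [h2, zero_mul], zero_mul, add_zero] at this
  have h4 : ∀ i < D, ∀ q < m, c (m * i + q) = 0 := fun i hi =>
    eq_zero_of_sum_range_mul_pow_eq_zero hη fun q hq => h3 q hq i hi
  funext x
  have hx : c x = v x := by simp [c]
  rw [← hx, Pi.zero_apply, ← Nat.div_add_mod (x : ℕ) m]
  rcases (Nat.div_le_div_right x.2.le : (x : ℕ) / m ≤ D).lt_or_eq with h | h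
  · exact h4 _ h _ (Nat.mod_lt _ hm)
  · rw [h]; exact h2 _

/-- The monomial matrix with reversed exponents of `x`, that is, `y^{⌊s/m⌋} x^{m-1-s mod m}`. -/
def reversedMonomialMatrix {R : Type*} [CommSemiring R] {ι : Type*} (m ν : ℕ) (μ ξ : ι → R) :
    Matrix ι (Fin ν) R :=
  Matrix.of fun t s => μ t ^ ((s : ℕ) / m) * ξ t ^ (m - 1 - (s : ℕ) % m)

lemma map_monomialMatrix {R S ι : Type*} [CommSemiring R] [CommSemiring S] (φ : R →+* S)
    (m ν : ℕ) (μ ξ : ι → R) :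
    (monomialMatrix m ν μ ξ).map φ = monomialMatrix m ν (φ ∘ μ) (φ ∘ ξ) := by
  ext; simp [monomialMatrix]

lemma map_reversedMonomialMatrix {R S ι : Type*} [CommSemiring R] [CommSemiring S] (φ : R →+* S)
    (m ν : ℕ) (μ ξ : ι → R) :
    (reversedMonomialMatrix m ν μ ξ).map φ = reversedMonomialMatrix m ν (φ ∘ μ) (φ ∘ ξ) := by
  ext; simp [reversedMonomialMatrix]

lemma reversedMonomialMatrix_apply_eq {ι : Type*} {m ν : ℕ} (hm : 0 < m) {μ ξ : ι → L} {t : ι}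
    (hξ : ξ t ≠ 0) (s : Fin ν) : reversedMonomialMatrix m ν μ ξ t s =
      ξ t ^ (m - 1) * (μ t ^ ((s : ℕ) / m) * (ξ t ^ ((s : ℕ) % m))⁻¹) := by
  have := Nat.mod_lt (s : ℕ) hm
  rw [reversedMonomialMatrix, Matrix.of_apply, pow_sub₀ _ hξ (by omega)]
  ring

lemma reversedMonomialMatrix_eq {ι : Type*} [Fintype ι] [DecidableEq ι] {m ν : ℕ} (hm : 0 < m)
    {μ ξ : ι → L} (hξ : ∀ t, ξ t ≠ 0) : reversedMonomialMatrix m ν μ ξ =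
      Matrix.diagonal (fun t => ξ t ^ (m - 1)) * monomialMatrix m ν μ ξ⁻¹ := by
  ext t s
  rw [reversedMonomialMatrix_apply_eq hm (hξ t), Matrix.diagonal_mul]
  simp [monomialMatrix]

lemma MvPolynomial.exists_eval_ne_zero [Infinite L] {ι : Type*} {F : MvPolynomial ι L}
    (hF : F ≠ 0) : ∃ x : ι → L, MvPolynomial.eval x F ≠ 0 := by
  by_contra! h
  exact hF (MvPolynomial.funext fun x => by rw [h x, map_zero])

lemma exists_nonzero_injective [Infinite L] :
    ∃ η : ℕ → L, Function.Injective η ∧ ∀ q, η q ≠ 0 := by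
  have h : ({0}ᶜ : Set L).Infinite := (Set.finite_singleton (0 : L)).infinite_compl
  exact ⟨fun q => h.natEmbedding _ q,
    Subtype.val_injective.comp (h.natEmbedding _).injective, fun q => (h.natEmbedding _ q).2⟩

/-- The grid may repeat abscissas, so it only shows that the determinants are nonzero polynomials in
`ξ`; a generic point then satisfies all conditions at once. -/
lemma exists_det_monomialMatrix_ne_zero [Infinite L] {m ν : ℕ} (hm : 0 < m) {μ : Fin ν → L}
    (hμ : ∀ t t' : Fin ν, (t : ℕ) % m = (t' : ℕ) % m → μ t = μ t' → t = t') :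
    ∃ ξ : Fin ν → L, Function.Injective ξ ∧ (∀ t, ξ t ≠ 0) ∧
      (monomialMatrix m ν μ ξ).det ≠ 0 ∧ (monomialMatrix m ν μ ξ⁻¹).det ≠ 0 := by
  obtain ⟨η, hη, hη0⟩ := exists_nonzero_injective (L := L)
  let μC : Fin ν → MvPolynomial (Fin ν) L := fun t => MvPolynomial.C (μ t)
  have hcomp : ∀ x : Fin ν → L, ⇑(MvPolynomial.eval x) ∘ μC = μ := fun x => by
    ext; simp [μC]
  have hX : ∀ x : Fin ν → L, ⇑(MvPolynomial.eval x) ∘ MvPolynomial.X = x := fun x => by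
    ext; simp
  set P := (monomialMatrix m ν μC MvPolynomial.X).det
  set Q := (reversedMonomialMatrix m ν μC MvPolynomial.X).det
  have hP : ∀ x, MvPolynomial.eval x P = (monomialMatrix m ν μ x).det := fun x => by
    rw [RingHom.map_det, RingHom.mapMatrix_apply, map_monomialMatrix, hcomp, hX]
  have hQ : ∀ x, MvPolynomial.eval x Q = (reversedMonomialMatrix m ν μ x).det := fun x => by
    rw [RingHom.map_det, RingHom.mapMatrix_apply, map_reversedMonomialMatrix, hcomp, hX]
  have hP0 : P ≠ 0 := fun h => det_monomialMatrix_grid_ne_zero hm hη.injOn hμ (by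
    rw [← hP, h, map_zero])
  have hQ0 : Q ≠ 0 := fun h => by
    have h1 := hQ fun t => η ((t : ℕ) % m)
    rw [h, map_zero, reversedMonomialMatrix_eq hm (fun t => hη0 _), Matrix.det_mul,
      Matrix.det_diagonal] at h1
    exact mul_ne_zero (Finset.prod_ne_zero_iff.2 fun t _ => pow_ne_zero _ (hη0 _))
      (det_monomialMatrix_grid_ne_zero (η := η⁻¹) hm
        (fun _ _ _ _ h => hη (inv_injective h)) hμ) h1.symm
  have hne : P * Q * (∏ t, MvPolynomial.X t) *
      (∏ t : Fin ν, ∏ t' ∈ Finset.univ.erase t, (MvPolynomial.X t - MvPolynomial.X t')) ≠ 0 := by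
    refine mul_ne_zero (mul_ne_zero (mul_ne_zero hP0 hQ0) ?_) ?_
    · exact Finset.prod_ne_zero_iff.2 fun t _ => MvPolynomial.X_ne_zero t
    · refine Finset.prod_ne_zero_iff.2 fun t _ => Finset.prod_ne_zero_iff.2 fun t' ht' => ?_
      exact sub_ne_zero.2 fun h => Finset.ne_of_mem_erase ht' (MvPolynomial.X_injective h).symm
  obtain ⟨x, hx⟩ := MvPolynomial.exists_eval_ne_zero hne
  simp only [map_mul, map_prod, map_sub, MvPolynomial.eval_X, hP, hQ] at hx
  have hx0 : ∀ t, x t ≠ 0 := fun t =>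
    Finset.prod_ne_zero_iff.1 (right_ne_zero_of_mul (left_ne_zero_of_mul hx)) t (Finset.mem_univ _)
  have hPQ := left_ne_zero_of_mul (left_ne_zero_of_mul hx)
  refine ⟨x, fun t t' htt => ?_, hx0, left_ne_zero_of_mul hPQ, fun h => ?_⟩
  · by_contra hne
    have h1 := Finset.prod_ne_zero_iff.1 (right_ne_zero_of_mul hx) t (Finset.mem_univ _)
    exact Finset.prod_ne_zero_iff.1 h1 t'
      (Finset.mem_erase.2 ⟨Ne.symm hne, Finset.mem_univ _⟩) (sub_eq_zero.2 htt)
  · apply right_ne_zero_of_mul hPQ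
    rw [reversedMonomialMatrix_eq hm hx0, Matrix.det_mul, h, mul_zero]

variable {ι : Type*} [DecidableEq ι]

/-- With exactly `ν` points the Gram matrix is a product of three square matrices, each nonsingular.
-/
lemma exists_det_weightedGram_ne_zero_of_card_eq [Infinite L] {m ν : ℕ} (hm : 0 < m)
    {μ : ι → L} (τ : Fin ν ↪ ι)
    (hμ : ∀ t t' : Fin ν, (t : ℕ) % m = (t' : ℕ) % m → μ (τ t) = μ (τ t') → t = t') :
    ∃ ξ : ι → L, Set.InjOn ξ (Finset.univ.map τ) ∧ (∀ k ∈ Finset.univ.map τ, ξ k ≠ 0) ∧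
      (weightedGram m ν (Finset.univ.map τ) ξ μ).det ≠ 0 := by
  obtain ⟨x, hx, hx0, h1, h2⟩ := exists_det_monomialMatrix_ne_zero hm (μ := μ ∘ τ) hμ
  let ξ : ι → L := Function.extend τ x 0
  have hξ : ∀ t, ξ (τ t) = x t := fun t => τ.injective.extend_apply _ _ _
  have hinj : Set.InjOn ξ (Finset.univ.map τ) := by
    intro k hk k' hk' h
    obtain ⟨t, -, rfl⟩ := Finset.mem_map.1 hk
    obtain ⟨t', -, rfl⟩ := Finset.mem_map.1 hk'
    rw [hξ, hξ] at h
    rw [hx h]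
  have h0 : ∀ k ∈ Finset.univ.map τ, ξ k ≠ 0 := by
    intro k hk
    obtain ⟨t, -, rfl⟩ := Finset.mem_map.1 hk
    rw [hξ]; exact hx0 t
  refine ⟨ξ, hinj, h0, ?_⟩
  have : weightedGram m ν (Finset.univ.map τ) ξ μ =
      (monomialMatrix m ν (μ ∘ τ) x⁻¹).transpose * Matrix.diagonal (fun t =>
        (ξ (τ t) * ∏ j ∈ (Finset.univ.map τ).erase (τ t), (ξ (τ t) - ξ j))⁻¹) *
      monomialMatrix m ν (μ ∘ τ) x := by
    ext u v
    rw [Matrix.mul_apply, weightedGram, Matrix.of_apply, Finset.sum_map]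
    refine Finset.sum_congr rfl fun t _ => ?_
    rw [Matrix.mul_diagonal, hξ]
    simp only [monomialMatrix, Matrix.of_apply, Matrix.transpose_apply, Pi.inv_apply, pow_add,
      Function.comp_apply, inv_pow]
    ring
  rw [this, Matrix.det_mul, Matrix.det_mul, Matrix.det_transpose, Matrix.det_diagonal]
  refine mul_ne_zero (mul_ne_zero h2 (Finset.prod_ne_zero_iff.2 fun t _ => ?_)) h1
  have ht : τ t ∈ Finset.univ.map τ := Finset.mem_map_of_mem _ (Finset.mem_univ _)
  exact inv_ne_zero (mul_ne_zero (h0 _ ht) (prod_sub_ne_zero hinj ht))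

/-- Adding a point near infinity, `ξ_a = 1/s` with `s` near `0`, preserves nonsingularity. -/
lemma exists_det_weightedGram_insert_ne_zero [Infinite L] {m ν : ℕ} (hm : 0 < m) {μ ξ : ι → L}
    {A : Finset ι} {a : ι} (ha : a ∉ A) (hA : m ≤ A.card) (hinj : Set.InjOn ξ A)
    (h0 : ∀ k ∈ A, ξ k ≠ 0) (hdet : (weightedGram m ν A ξ μ).det ≠ 0) :
    ∃ ξ' : ι → L, Set.InjOn ξ' (insert a A : Finset ι) ∧ (∀ k ∈ insert a A, ξ' k ≠ 0) ∧
      (weightedGram m ν (insert a A) ξ' μ).det ≠ 0 := by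
  -- This is the Gram matrix of `insert a A` at `ξ_a = 1/s`, divided by the scalar `z` below. Since
  -- `m ≤ A.card`, the new point's term has a positive power of `s`, so `s = 0` recovers the Gram
  -- matrix of `A`.
  let N : Matrix (Fin ν) (Fin ν) L[X] := Matrix.of fun u v =>
    ∑ k ∈ A, C ((ξ k * ∏ j ∈ A.erase k, (ξ k - ξ j))⁻¹ *
      μ k ^ ((u : ℕ) / m + (v : ℕ) / m) * ξ k ^ ((v : ℕ) % m) * (ξ k ^ ((u : ℕ) % m))⁻¹) *
      ∏ l ∈ A.erase k, (1 - C (ξ l) * X) -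
    C (μ a ^ ((u : ℕ) / m + (v : ℕ) / m)) * X ^ (A.card + (u : ℕ) % m - (v : ℕ) % m)
  have hexp : ∀ u v : Fin ν, (v : ℕ) % m < A.card + (u : ℕ) % m := fun u v => by
    have := Nat.mod_lt (v : ℕ) hm
    omega
  have hN : ∀ s, N.det.eval s = (N.map (eval s)).det := fun s => by
    rw [← coe_evalRingHom, RingHom.map_det]; rfl
  have hN0 : N.map (eval 0) = weightedGram m ν A ξ μ := by
    ext u v
    have := hexp u v
    simp [N, weightedGram, eval_finsetSum, eval_prod,
      zero_pow (show A.card + (u : ℕ) % m - (v : ℕ) % m ≠ 0 by omega)]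
  have hne : N.det * X * ∏ l ∈ A, (1 - C (ξ l) * X) ≠ 0 := by
    refine mul_ne_zero (mul_ne_zero (fun h => hdet ?_) X_ne_zero)
      (Finset.prod_ne_zero_iff.2 fun l _ h => ?_)
    · rw [← hN0, ← hN, h, eval_zero]
    · simpa using congrArg (eval 0) h
  obtain ⟨s, hs⟩ : ∃ s, eval s (N.det * X * ∏ l ∈ A, (1 - C (ξ l) * X)) ≠ 0 := by
    by_contra! h
    exact hne (Polynomial.funext fun x => by rw [h x, eval_zero])
  simp only [eval_mul, eval_prod, eval_X, eval_sub, eval_one, eval_C] at hs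
  have hs0 : s ≠ 0 := right_ne_zero_of_mul (left_ne_zero_of_mul hs)
  have hsl : ∀ l ∈ A, 1 - ξ l * s ≠ 0 := Finset.prod_ne_zero_iff.1 (right_ne_zero_of_mul hs)
  have hsl' : ∀ l ∈ A, ξ l ≠ s⁻¹ := fun l hl h => hsl l hl (by
    rw [h, inv_mul_cancel₀ hs0, sub_self])
  have hupd : ∀ k ∈ A, Function.update ξ a s⁻¹ k = ξ k := fun k hk =>
    Function.update_of_ne (fun h => ha (by rwa [← h])) _ _
  refine ⟨Function.update ξ a s⁻¹, ?_, ?_, ?_⟩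
  · rw [Finset.coe_insert, Set.injOn_insert (by simpa using ha)]
    refine ⟨hinj.congr fun k hk => (hupd k hk).symm, ?_⟩
    rintro ⟨k, hk, h⟩
    rw [hupd k hk, Function.update_self] at h
    exact hsl' k hk h
  · intro k hk
    rcases Finset.mem_insert.1 hk with rfl | hk
    · rw [Function.update_self]; exact inv_ne_zero hs0
    · rw [hupd k hk]; exact h0 k hk
  · set z := -s * (∏ l ∈ A, (1 - ξ l * s))⁻¹ with hz
    have hz0 : z ≠ 0 := mul_ne_zero (neg_ne_zero.2 hs0) (inv_ne_zero (right_ne_zero_of_mul hs))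
    have hB : weightedGram m ν (insert a A) (Function.update ξ a s⁻¹) μ =
        z • N.map (eval s) := by
      ext u v
      rw [weightedGram, Matrix.of_apply, Finset.sum_insert ha, Finset.erase_insert ha,
        Function.update_self, Matrix.smul_apply, Matrix.map_apply]
      simp only [N, Matrix.of_apply, eval_sub, eval_finsetSum, eval_mul, eval_prod, eval_C,
        eval_one, eval_X, eval_pow, smul_eq_mul, mul_sub, Finset.mul_sum]
      rw [sub_eq_neg_add]
      congr 1
      · have h1 : ∏ j ∈ A, (s⁻¹ - Function.update ξ a s⁻¹ j) =
            (s ^ A.card)⁻¹ * ∏ l ∈ A, (1 - ξ l * s) := by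
          rw [← inv_pow, ← Finset.prod_const, ← Finset.prod_mul_distrib]
          refine Finset.prod_congr rfl fun j hj => ?_
          rw [hupd j hj]
          field_simp
        rw [h1, pow_sub₀ _ hs0 (hexp u v).le, hz, pow_add]
        have := right_ne_zero_of_mul hs
        simp only [mul_inv, inv_inv, inv_pow]
        ring
      · refine Finset.sum_congr rfl fun k hk => ?_
        have hka : a ≠ k := fun h => ha (h ▸ hk)
        rw [hupd k hk, Finset.erase_insert_of_ne hka,
          Finset.prod_insert (fun h => ha (Finset.mem_of_mem_erase h)), Function.update_self,
          Finset.prod_congr rfl fun j hj => by rw [hupd j (Finset.mem_of_mem_erase hj)]]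
        have h2 : z * ∏ l ∈ A.erase k, (1 - ξ l * s) = (ξ k - s⁻¹)⁻¹ := by
          rw [hz, ← Finset.mul_prod_erase A _ hk, mul_inv, mul_assoc, mul_assoc,
            inv_mul_cancel₀ (Finset.prod_ne_zero_iff.2 fun l hl =>
              hsl l (Finset.mem_of_mem_erase hl)), mul_one]
          have h3 := hsl k hk
          refine eq_inv_of_mul_eq_one_left ?_
          rw [mul_comm (-s), mul_assoc,
            inv_mul_eq_one₀ h3, neg_mul, mul_sub, mul_inv_cancel₀ hs0]
          ring
        simp only [mul_inv, ← h2]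
        ring
    rw [hB, Matrix.det_smul, ← hN]
    exact mul_ne_zero (pow_ne_zero _ hz0) (left_ne_zero_of_mul (left_ne_zero_of_mul hs))

lemma exists_det_weightedGram_ne_zero [Infinite L] [Fintype ι] {m ν : ℕ} (hm : 0 < m)
    (hν : m ≤ ν) {μ : ι → L} (τ : Fin ν ↪ ι)
    (hμ : ∀ t t' : Fin ν, (t : ℕ) % m = (t' : ℕ) % m → μ (τ t) = μ (τ t') → t = t') :
    ∃ ξ : ι → L, Function.Injective ξ ∧ (∀ k, ξ k ≠ 0) ∧
      (weightedGram m ν Finset.univ ξ μ).det ≠ 0 := by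
  have key : ∀ T : Finset ι, Disjoint T (Finset.univ.map τ) → ∃ ξ : ι → L,
      Set.InjOn ξ (T ∪ Finset.univ.map τ : Finset ι) ∧
      (∀ k ∈ T ∪ Finset.univ.map τ, ξ k ≠ 0) ∧
      (weightedGram m ν (T ∪ Finset.univ.map τ) ξ μ).det ≠ 0 := by
    intro T
    induction T using Finset.induction_on with
    | empty =>
      intro _
      rw [Finset.empty_union]
      exact exists_det_weightedGram_ne_zero_of_card_eq hm τ hμ
    | insert a T ha ih =>
      intro hT
      rw [Finset.disjoint_insert_left] at hT
      obtain ⟨ξ, h1, h2, h3⟩ := ih hT.2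
      rw [Finset.insert_union]
      refine exists_det_weightedGram_insert_ne_zero hm ?_ ?_ h1 h2 h3
      · exact fun h => (Finset.mem_union.1 h).elim ha hT.1
      · refine (hν.trans ?_).trans (Finset.card_le_card Finset.subset_union_right)
        rw [Finset.card_map, Finset.card_univ, Fintype.card_fin]
  obtain ⟨ξ, h1, h2, h3⟩ := key (Finset.univ.map τ)ᶜ disjoint_compl_left
  have hu : (Finset.univ.map τ)ᶜ ∪ Finset.univ.map τ = Finset.univ := by
    rw [Finset.union_comm]; exact Finset.union_compl _
  rw [hu] at h1 h2 h3
  exact ⟨ξ, by simpa using h1, fun k => h2 k (Finset.mem_univ k), h3⟩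

end Nonvanishing

/-! ### The bordered determinant and its degree -/

section Gamma

/-- A bordered matrix whose determinant is, up to units at distinct nonzero points, that of
`weightedGram`. -/
def borderedMatrix {R : Type*} [CommRing R] {n : ℕ} (m ν : ℕ) (ξ μ : Fin n → R) :
    Matrix (Fin n ⊕ Fin ν) (Fin n ⊕ Fin ν) R :=
  Matrix.fromBlocks
    (Matrix.diagonal fun k => ξ k ^ m * ∏ j ∈ Finset.univ.erase k, (ξ k - ξ j))
    (monomialMatrix m ν μ ξ) (reversedMonomialMatrix m ν μ ξ).transpose 0

lemma map_det_borderedMatrix {R S : Type*} [CommRing R] [CommRing S] (φ : R →+* S) {n : ℕ}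
    (m ν : ℕ) (ξ μ : Fin n → R) :
    φ (borderedMatrix m ν ξ μ).det = (borderedMatrix m ν (φ ∘ ξ) (φ ∘ μ)).det := by
  rw [RingHom.map_det, RingHom.mapMatrix_apply, borderedMatrix, Matrix.fromBlocks_map,
    map_monomialMatrix, Matrix.transpose_map, map_reversedMonomialMatrix, Matrix.diagonal_map
    (map_zero φ), Matrix.map_zero _ (map_zero φ), borderedMatrix]
  simp [Function.comp_def]

/-- Schur complement of the diagonal block. Its factor `ξ_k^m` supplies `m - 1` powers for the
reversed exponents and one for the weight in the Gram matrix. -/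
lemma det_borderedMatrix_ne_zero_iff {L : Type*} [Field L] {n m : ℕ} (ν : ℕ) (hm : 0 < m)
    {ξ : Fin n → L} (μ : Fin n → L) (hξ : Function.Injective ξ) (h0 : ∀ k, ξ k ≠ 0) :
    (borderedMatrix m ν ξ μ).det ≠ 0 ↔ (weightedGram m ν Finset.univ ξ μ).det ≠ 0 := by
  set g : Fin n → L := fun k => ξ k ^ m * ∏ j ∈ Finset.univ.erase k, (ξ k - ξ j) with hg
  have hg0 : ∀ k, g k ≠ 0 := fun k =>
    mul_ne_zero (pow_ne_zero _ (h0 k)) (prod_sub_ne_zero hξ.injOn (Finset.mem_univ k))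
  let _ : Invertible (Matrix.diagonal g) :=
    ⟨Matrix.diagonal fun k => (g k)⁻¹, by simp [Matrix.diagonal_mul_diagonal, hg0],
      by simp [Matrix.diagonal_mul_diagonal, hg0]⟩
  have hinv : ⅟(Matrix.diagonal g) = Matrix.diagonal fun k => (g k)⁻¹ := rfl
  have hB : (0 : Matrix (Fin ν) (Fin ν) L) - (reversedMonomialMatrix m ν μ ξ).transpose *
      ⅟(Matrix.diagonal g) * monomialMatrix m ν μ ξ = -weightedGram m ν Finset.univ ξ μ := by
    rw [zero_sub, hinv]
    congr 1
    ext s t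
    rw [Matrix.mul_apply, weightedGram, Matrix.of_apply]
    refine Finset.sum_congr rfl fun k _ => ?_
    rw [Matrix.mul_diagonal, Matrix.transpose_apply, reversedMonomialMatrix_apply_eq hm (h0 k),
      monomialMatrix, Matrix.of_apply, hg]
    have h1 : ξ k ^ m = ξ k ^ (m - 1) * ξ k := by rw [← pow_succ, Nat.sub_add_cancel hm]
    have h2 : ξ k ^ (m - 1) * (ξ k ^ (m - 1))⁻¹ = 1 := mul_inv_cancel₀ (pow_ne_zero _ (h0 k))
    simp only [h1, mul_inv, pow_add]
    linear_combination (μ k ^ ((s : ℕ) / m) * (ξ k ^ ((s : ℕ) % m))⁻¹ * (ξ k)⁻¹ *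
      (∏ j ∈ Finset.univ.erase k, (ξ k - ξ j))⁻¹ * μ k ^ ((t : ℕ) / m) *
      ξ k ^ ((t : ℕ) % m)) * h2
  rw [borderedMatrix, Matrix.det_fromBlocks₁₁, hB, Matrix.det_neg, Matrix.det_diagonal]
  rw [mul_ne_zero_iff, mul_ne_zero_iff]
  exact ⟨fun h => h.2.2, fun h => ⟨Finset.prod_ne_zero_iff.2 fun k _ => hg0 k,
    pow_ne_zero _ (neg_ne_zero.2 one_ne_zero), h⟩⟩

/-- Every term of the expansion has the same total weight. Integer weights, with zero entries
exempt, allow negative bounds on a zero block. -/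
lemma totalDegree_det_le {R κ ι : Type*} [CommRing R] [Fintype ι] [DecidableEq ι]
    (M : Matrix ι ι (MvPolynomial κ R)) (w z : ι → ℤ)
    (h : ∀ i j, M i j ≠ 0 → ((M i j).totalDegree : ℤ) ≤ w i + z j) {b : ℕ}
    (hb : ∑ i, w i + ∑ i, z i ≤ b) : M.det.totalDegree ≤ b := by
  rw [Matrix.det_apply]
  refine MvPolynomial.totalDegree_finsetSum_le fun s _ => ?_
  have key : (∏ i, M (s i) i).totalDegree ≤ b := by
    by_cases h0 : ∀ i, M (s i) i ≠ 0
    · zify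
      calc ((∏ i, M (s i) i).totalDegree : ℤ) ≤ ((∑ i, (M (s i) i).totalDegree : ℕ) : ℤ) :=
            Nat.cast_le.2 (MvPolynomial.totalDegree_finsetProd _ _)
        _ ≤ ∑ i, (w (s i) + z i) := by
            push_cast
            exact Finset.sum_le_sum fun i _ => h _ _ (h0 i)
        _ ≤ b := by
            rw [Finset.sum_add_distrib, Equiv.sum_comp s w]
            exact hb
    · push Not at h0
      obtain ⟨i, hi⟩ := h0
      have h1 : ∏ i, M (s i) i = 0 := Finset.prod_eq_zero (Finset.mem_univ i) hi
      simp [h1]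
  rcases Int.units_eq_one_or (Equiv.Perm.sign s) with hs | hs
  · rwa [hs, one_smul]
  · rwa [hs, Units.neg_smul, one_smul, MvPolynomial.totalDegree_neg]

lemma totalDegree_C_pow_mul_X_pow_le {R κ : Type*} [CommRing R] [Nontrivial R] (a : R) (k : κ) (i j : ℕ) :
    (MvPolynomial.C a ^ i * MvPolynomial.X k ^ j : MvPolynomial κ R).totalDegree ≤ j := by
  refine (MvPolynomial.totalDegree_mul _ _).trans ?_
  rw [← map_pow, MvPolynomial.totalDegree_C, MvPolynomial.totalDegree_X_pow, zero_add]

lemma totalDegree_det_borderedMatrix_le {R : Type*} [CommRing R] [Nontrivial R] {n m : ℕ}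
    (ν : ℕ) (hm : 1 ≤ m)
    (hmn : m ≤ n) (μ : Fin n → R) :
    (borderedMatrix m ν (MvPolynomial.X : Fin n → MvPolynomial (Fin n) R)
      fun k => MvPolynomial.C (μ k)).det.totalDegree ≤ 2 * n ^ 2 := by
  -- The weights bound the three nonzero blocks by `m + n - 1`, `m - 1`, `m - 1` and sum to `n(m + n
  -- - 1) - ν(n + 1 - m)`, at most `2n²`.
  refine totalDegree_det_le _ (Sum.elim (fun _ => 0) fun _ => -(n : ℤ))
    (Sum.elim (fun _ => (m : ℤ) + n - 1) fun _ => (m : ℤ) - 1) ?_ ?_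
  · rintro (k | s) (k' | t) hne
    · by_cases hk : k = k'
      · subst hk
        simp only [borderedMatrix, Matrix.fromBlocks_apply₁₁, Matrix.diagonal_apply_eq,
          Sum.elim_inl]
        have h1 : (∏ j ∈ Finset.univ.erase k, (MvPolynomial.X k - MvPolynomial.X j) :
            MvPolynomial (Fin n) R).totalDegree ≤ n - 1 := by
          refine (MvPolynomial.totalDegree_finsetProd _ _).trans ?_
          refine (Finset.sum_le_card_nsmul _ _ 1 fun j _ => ?_).trans ?_
          · refine (MvPolynomial.totalDegree_sub _ _).trans ?_
            simp [MvPolynomial.totalDegree_X]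
          · simp
        have h2 := MvPolynomial.totalDegree_mul (MvPolynomial.X k ^ m)
          (∏ j ∈ Finset.univ.erase k, (MvPolynomial.X k - MvPolynomial.X j) :
            MvPolynomial (Fin n) R)
        rw [MvPolynomial.totalDegree_X_pow] at h2
        omega
      · simp [borderedMatrix, hk] at hne
    · have h := totalDegree_C_pow_mul_X_pow_le (μ k) k ((t : ℕ) / m) ((t : ℕ) % m)
      have := Nat.mod_lt (t : ℕ) hm
      simp only [borderedMatrix, Matrix.fromBlocks_apply₁₂, monomialMatrix, Matrix.of_apply,
        Sum.elim_inl, Sum.elim_inr]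
      omega
    · have h := totalDegree_C_pow_mul_X_pow_le (μ k') k' ((s : ℕ) / m) (m - 1 - (s : ℕ) % m)
      simp only [borderedMatrix, Matrix.fromBlocks_apply₂₁, Matrix.transpose_apply,
        reversedMonomialMatrix, Matrix.of_apply, Sum.elim_inl, Sum.elim_inr]
      omega
    · simp [borderedMatrix] at hne
  · simp only [Fintype.sum_sum_type, Sum.elim_inl, Sum.elim_inr, Finset.sum_const,
      Finset.card_univ, Fintype.card_fin, smul_zero, nsmul_eq_mul, zero_add]
    push_cast
    have h1 : (m : ℤ) ≤ n := by exact_mod_cast hmn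
    have h2 : (0 : ℤ) ≤ ν * (n + 1 - m) := mul_nonneg (by positivity) (by linarith)
    have h3 : (0 : ℤ) ≤ n * (n + 1 - m) := mul_nonneg (by positivity) (by linarith)
    nlinarith

end Gamma

/-! ### Classes of equal values and the polynomial `Γ` -/

section Classes

variable {r : ℕ} {ℓ : Fin r → ℕ}

/-- The index of the class containing a given point, for consecutive classes of sizes `ℓ_i`. -/
def classIndex (ℓ : Fin r → ℕ) (k : Fin (∑ i, ℓ i)) : Fin r :=
  (finSigmaFinEquiv.symm k).1

lemma TakesValues.aeval_eq {K L : Type*} [Field K] [Field L] [Algebra K L] {a : K[X]}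
    {xi : Fin (∑ i, ℓ i) → L} {lam : Fin r → L} (h : TakesValues a xi lam ℓ)
    (k : Fin (∑ i, ℓ i)) : aeval (xi k) a = lam (classIndex ℓ k) := by
  obtain ⟨⟨i, b⟩, rfl⟩ := finSigmaFinEquiv.surjective k
  have hsum : ∑ j ∈ Finset.Iio i, ℓ j = ∑ j : Fin i, ℓ (Fin.castLE i.2.le j) := by
    have : Finset.Iio i = Finset.univ.map (Fin.castLEEmb i.2.le) := by
      ext j
      simp only [Finset.mem_Iio, Finset.mem_map, Finset.mem_univ, true_and]
      exact ⟨fun hj => ⟨⟨j, hj⟩, rfl⟩, by rintro ⟨x, rfl⟩; exact x.2⟩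
    rw [this, Finset.sum_map]
    rfl
  have hval := finSigmaFinEquiv_apply (n := ℓ) ⟨i, b⟩
  rw [classIndex, Equiv.symm_apply_apply]
  refine h.value i _ ?_ ?_ <;> rw [hsum, hval]
  · exact Nat.le_add_right _ _
  · exact Nat.add_lt_add_left b.2 _

lemma card_classIndex_eq (i : Fin r) :
    (Finset.univ.filter (classIndex ℓ · = i)).card = ℓ i := by
  have : Finset.univ.filter (classIndex ℓ · = i) =
      Finset.univ.image fun b : Fin (ℓ i) => finSigmaFinEquiv ⟨i, b⟩ := by
    ext k
    obtain ⟨⟨j, b⟩, rfl⟩ := finSigmaFinEquiv.surjective k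
    have hj : classIndex ℓ (finSigmaFinEquiv ⟨j, b⟩) = j := by simp [classIndex]
    rw [Finset.mem_filter, Finset.mem_image, hj]
    simp only [Finset.mem_univ, true_and, EmbeddingLike.apply_eq_iff_eq]
    constructor
    · rintro rfl; exact ⟨b, rfl⟩
    · rintro ⟨c, hc⟩; exact (congrArg Sigma.fst hc).symm
  rw [this, Finset.card_image_of_injective _ fun b c hbc => by simpa using hbc]
  simp

/-- A choice of `min(ℓ_i, m)` points in each class, numbered in such a way that points of the
same class have distinct numbers modulo `m`. -/
lemma exists_embedding_classIndex (ℓ : Fin r → ℕ) (m : ℕ) :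
    ∃ τ : Fin (∑ i, min (ℓ i) m) ↪ Fin (∑ i, ℓ i), ∀ t t' : Fin (∑ i, min (ℓ i) m),
      (t : ℕ) % m = (t' : ℕ) % m → classIndex ℓ (τ t) = classIndex ℓ (τ t') → t = t' := by
  let g : (Σ i, Fin (min (ℓ i) m)) → (Σ i, Fin (ℓ i)) := fun x =>
    ⟨x.1, Fin.castLE (min_le_left _ _) x.2⟩
  have hg : Function.Injective g := by
    rintro ⟨i, b⟩ ⟨j, c⟩ h
    obtain rfl : i = j := congrArg Sigma.fst h
    simpa [g] using h
  refine ⟨⟨fun t => finSigmaFinEquiv (g (finSigmaFinEquiv.symm t)),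
    finSigmaFinEquiv.injective.comp (hg.comp finSigmaFinEquiv.symm.injective)⟩, ?_⟩
  intro t t' hmod hcl
  obtain ⟨⟨i, b⟩, rfl⟩ := finSigmaFinEquiv.surjective t
  obtain ⟨⟨j, c⟩, rfl⟩ := finSigmaFinEquiv.surjective t'
  simp only [Function.Embedding.coeFn_mk, classIndex, Equiv.symm_apply_apply, g] at hcl
  subst hcl
  rw [finSigmaFinEquiv_apply, finSigmaFinEquiv_apply] at hmod
  have h1 : (b : ℕ) ≡ c [MOD m] := Nat.ModEq.add_left_cancel' _ hmod
  have h2 : (b : ℕ) = c := h1.eq_of_lt_of_lt (b.2.trans_le (min_le_right _ _))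
    (c.2.trans_le (min_le_right _ _))
  rw [Fin.ext h2]

/-- Provides `m ≤ ν`, needed to bring in points from infinity. -/
lemma le_sum_min {m : ℕ} (h : m ≤ ∑ i, ℓ i) : m ≤ ∑ i, min (ℓ i) m := by
  by_cases h1 : ∃ i, m ≤ ℓ i
  · obtain ⟨i, hi⟩ := h1
    exact (min_eq_right hi).ge.trans
      (Finset.single_le_sum (f := fun i => min (ℓ i) m) (fun _ _ => Nat.zero_le _)
        (Finset.mem_univ i))
  · push Not at h1
    rwa [Finset.sum_congr rfl fun i _ => min_eq_left (h1 i).le]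

/-- The polynomial whose nonvanishing ensures that the block Hankel matrix has maximal rank. -/
noncomputable def genericityPolynomial (ℓ : Fin r → ℕ) (m : ℕ) :
    MvPolynomial (Fin (∑ i, ℓ i) ⊕ Fin r) ℤ :=
  (borderedMatrix m (∑ i, min (ℓ i) m) (fun k => MvPolynomial.X (Sum.inl k))
    fun k => MvPolynomial.X (Sum.inr (classIndex ℓ k))).det

lemma aeval_genericityPolynomial {S : Type*} [CommRing S] [Algebra ℤ S] (m : ℕ) (ξ : Fin (∑ i, ℓ i) → S)
    (lam : Fin r → S) : MvPolynomial.aeval (Sum.elim ξ lam) (genericityPolynomial ℓ m) =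
      (borderedMatrix m (∑ i, min (ℓ i) m) ξ fun k => lam (classIndex ℓ k)).det := by
  rw [genericityPolynomial]
  refine (map_det_borderedMatrix (R := MvPolynomial (Fin (∑ i, ℓ i) ⊕ Fin r) ℤ)
    (MvPolynomial.aeval (R := ℤ) (Sum.elim ξ lam) : _ →ₐ[ℤ] S).toRingHom _ _ _ _).trans ?_
  simp [Function.comp_def]

lemma aeval_genericityPolynomial_ne_zero {L : Type*} [Field L] [Infinite L] {m : ℕ} (hm : 1 ≤ m)
    (hmn : m ≤ ∑ i, ℓ i) {lam : Fin r → L} (hlam : Function.Injective lam) :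
    (MvPolynomial.aeval (Sum.elim MvPolynomial.X fun i => MvPolynomial.C (lam i))
      (genericityPolynomial ℓ m) : MvPolynomial (Fin (∑ i, ℓ i)) L) ≠ 0 := by
  obtain ⟨τ, hτ⟩ := exists_embedding_classIndex ℓ m
  obtain ⟨x, hx, hx0, hdet⟩ := exists_det_weightedGram_ne_zero hm (le_sum_min hmn)
    (μ := fun k => lam (classIndex ℓ k)) τ fun t t' h1 h2 => hτ t t' h1 (hlam h2)
  rw [← det_borderedMatrix_ne_zero_iff _ hm _ hx hx0] at hdet
  intro h
  apply hdet
  rw [aeval_genericityPolynomial] at h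
  have h1 := map_det_borderedMatrix (MvPolynomial.eval x) m (∑ i, min (ℓ i) m)
    MvPolynomial.X fun k => MvPolynomial.C (lam (classIndex ℓ k))
  rw [h, map_zero] at h1
  rw [h1]
  congr 2 <;> ext k <;> simp

end Classes

end BlockHankel

/-! ### The proposition -/

theorem mainTheorem11 (n r m : ℕ) (ℓ : Fin r → ℕ) (hℓ : ∀ i, 0 < ℓ i) (hsum : ∑ i, ℓ i = n)
    (hm : 1 ≤ m) (hmn : m ≤ n) :
    ∃ Γ : MvPolynomial (Fin n ⊕ Fin r) ℤ, Γ ≠ 0 ∧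
      ∀ (K L : Type*) [Field K] [Field L] [Algebra K L] [IsAlgClosure K L],
        (∀ (xi : Fin n → L) (lam : Fin r → L) (c : K) (f a : K[X]),
          Function.Injective xi → (∀ k, xi k ≠ 0) → c ≠ 0 →
          f.map (algebraMap K L) = C (algebraMap K L c) * ∏ k, (X - C (xi k)) →
          BlockHankel.TakesValues a xi lam ℓ →
            BlockHankel.nu n m a f = ∑ i, min (ℓ i) m ∧
            (MvPolynomial.aeval (Sum.elim xi lam) Γ ≠ 0 →
              ∀ d : ℕ, ⌈(BlockHankel.nu n m a f : ℚ) / (m : ℚ)⌉₊ ≤ d →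
                (BlockHankel.blockHankel n m d a f).rank = BlockHankel.nu n m a f)) ∧
        (∀ lam : Fin r → L, Function.Injective lam →
          (MvPolynomial.aeval
            (Sum.elim MvPolynomial.X fun i => MvPolynomial.C (lam i)) Γ :
              MvPolynomial (Fin n) L) ≠ 0 ∧
          (MvPolynomial.aeval
            (Sum.elim MvPolynomial.X fun i => MvPolynomial.C (lam i)) Γ :
              MvPolynomial (Fin n) L).totalDegree ≤ 2 * n ^ 2) := by
  subst hsum
  refine ⟨BlockHankel.genericityPolynomial ℓ m, fun h0 => ?_, ?_⟩
  -- A nonzero specialization, at the distinct rational values `λ_i = i`, shows `Γ ≠ 0` over `ℤ`.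
  · refine BlockHankel.aeval_genericityPolynomial_ne_zero (L := ℚ) hm hmn
      (lam := fun i => ((i : ℕ) : ℚ)) (fun i j h => Fin.ext (Nat.cast_injective h)) ?_
    rw [h0, map_zero]
  · intro K L _ _ _ _
    have : IsAlgClosed L := IsAlgClosure.isAlgClosed K
    have : Infinite L := IsAlgClosed.instInfinite
    refine ⟨?_, fun lam hlam =>
      ⟨BlockHankel.aeval_genericityPolynomial_ne_zero hm hmn hlam, ?_⟩⟩
    · intro xi lam c f a hxi hxi0 hc hf ha
      have hn : 0 < ∑ i, ℓ i := hm.trans hmn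
      have hσ := ha.aeval_eq
      have hV := BlockHankel.vandermonde_mul_mulMatrix a hc hn hf
      simp only [hσ] at hV
      have hnu : BlockHankel.nu (∑ i, ℓ i) m a f = ∑ i, min (ℓ i) m := by
        rw [BlockHankel.nu, BlockHankel.sum_natDegree_invariantFactor ha.distinct
          (BlockHankel.classIndex ℓ) _ (BlockHankel.vandermonde_mul_lagrangeMatrix hxi) hV hmn]
        simp only [BlockHankel.card_classIndex_eq]
      refine ⟨hnu, fun hΓ d hd => ?_⟩
      rw [hnu] at hd ⊢
      have hνd : ∑ i, min (ℓ i) m ≤ m * d := by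
        have hm' : (0 : ℚ) < m := by exact_mod_cast hm
        have h1 := Nat.ceil_le.1 hd
        rw [div_le_iff₀ hm'] at h1
        rw [mul_comm]
        exact_mod_cast h1
      apply le_antisymm
      · refine (BlockHankel.rank_blockHankel_le hxi hc hn hf hmn
          (BlockHankel.classIndex ℓ) lam hσ).trans_eq ?_
        simp only [BlockHankel.card_classIndex_eq]
      · rw [BlockHankel.aeval_genericityPolynomial,
          BlockHankel.det_borderedMatrix_ne_zero_iff _ hm _ hxi hxi0] at hΓ
        refine BlockHankel.le_rank_blockHankel hxi hxi0 hc hm hmn hf hνd ?_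
        simpa only [hσ] using hΓ
    · rw [BlockHankel.aeval_genericityPolynomial]
      exact BlockHankel.totalDegree_det_borderedMatrix_le _ hm hmn _
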